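/- Let $n, r \ge 1$ be integers, let $G \le S_n$ be a transitive permutation group of degree $n$, and let $G$ act on $(\mathbb{A}^n)^r$ diagonally, by permuting the $n$ coordinates in each copy of $\mathbb{A}^n$. Let $\mathcal{I} = \{f_1,\dots,f_{nr}\}$ be a set of $nr$ algebraically independent $G$-invariant polynomials on $(\mathbb{A}^n)^r$ with coefficients in $\mathbb{Z}$. Put $\deg\mathcal{I} := \sum_{i=1}^{nr} \deg f_i$ (total degrees) and $\mathcal{I}(1) := \prod_{i=1}^{nr} |f_i|(1)$, where $|f_i|$ is obtained from $f_i$ by replacing each coefficient by its absolute value and $|f_i|(1)$ is its value at $(1,\dots,1)$. For a number field $k$, with a fixed algebraic closure $\overline{k}$, and $X \ge 1$, let $\mathcal{F}_{n,k}(X;G)$ be the set of extensions $K/k$ inside $\overline{k}$ such that $[K:k]=n$, the absolute discriminant satisfies $|\mathrm{Disc}(K)| \le X$, and $\mathrm{Gal}(\widetilde{K}/k)$, viewed as a permutation group through its action on the $n$ $k$-embeddings of $K$ into its normal closure $\widetilde{K}$ over $k$, is isomorphic to $G$ as a permutation group. For a number field $K$ of degree $m$ over $\mathbb{Q}$ and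 $\alpha\in\mathcal{O}_K$, let $\|\alpha\| := \max_{v\mid\infty} |\alpha|_v$, and let $\lambda_{\max}(K)$ be the largest Minkowski successive minimum of $\mathcal{O}_K$, that is, the smallest $\lambda$ such that $\{\alpha\in\mathcal{O}_K : \|\alpha\|\le\lambda\}$ spans a $\mathbb{Q}$-vector space of dimension $m$. Then for every number field $k$ and every $X \ge 1$, the set $\mathcal{F}_{n,k}(X;G)$ is finite and $$\#\mathcal{F}_{n,k}(X;G) \ll_{n,[k:\mathbb{Q}],r,\mathcal{I}} X^{\frac{1}{n}\deg\mathcal{I}-\frac{r}{2}}\, |\mathrm{Disc}(k)|^{-\frac{nr}{2}}.$$ More explicitly, if $d=[k:\mathbb{Q}]$ and $$C := (2\pi)^{dnr}\, d!^{\,nr}\, \mathcal{I}(1)^d \left(2dn\left(\deg\mathcal{I}+\binom{n}{2}\right)\right)^{d\deg\mathcal{I}},$$ then for all $X,\lambda\ge 1$, $$\#\{K\in\mathcal{F}_{n,k}(X;G) : \lambda_{\max}(K)\le\lambda\} \le C\cdot \frac{\lambda^{d\deg\mathcal{I}-dnr}\, X^{\frac{r}{2}}}{|\mathrm{Disc}(k)|^{nr/2}},$$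 and $$\#\mathcal{F}_{n,k}(X;G) \le C\cdot \frac{X^{\frac{1}{n}\deg\mathcal{I}-\frac{r}{2}}}{|\mathrm{Disc}(k)|^{rn/2}}.$$ -/

import Mathlib

open scoped NumberField

noncomputable section

namespace InvariantBound

/-- The diagonal action of a permutation of the `n` coordinates of `𝔸ⁿ` on polynomials on
`(𝔸ⁿ)ʳ`; the variable `(j, i)` is the `i`-th coordinate on the `j`-th copy of `𝔸ⁿ`. -/
def permute {n r : ℕ} (σ : Equiv.Perm (Fin n)) (f : MvPolynomial (Fin r × Fin n) ℤ) :
    MvPolynomial (Fin r × Fin n) ℤ :=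
  MvPolynomial.rename (fun x => (x.1, σ x.2)) f

/-- `f` is invariant under the diagonal action of `G` on `(𝔸ⁿ)ʳ`. -/
def IsInvariant {n r : ℕ} (G : Subgroup (Equiv.Perm (Fin n)))
    (f : MvPolynomial (Fin r × Fin n) ℤ) : Prop :=
  ∀ σ ∈ G, permute σ f = f

/-- The polynomial `|f|`: every coefficient is replaced by its absolute value. -/
def absPoly {τ : Type*} (f : MvPolynomial τ ℤ) : MvPolynomial τ ℤ :=
  ∑ m ∈ f.support, MvPolynomial.monomial m |f.coeff m|

/-- `𝓘(1) = ∏ᵢ |fᵢ|(1)`. -/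
def evalOne {τ ι : Type*} [Fintype ι] (f : ι → MvPolynomial τ ℤ) : ℤ :=
  ∏ i, MvPolynomial.eval (fun _ => (1 : ℤ)) (absPoly (f i))

/-- `deg 𝓘 = ∑ᵢ deg fᵢ`. -/
def degSum {τ ι : Type*} [Fintype ι] (f : ι → MvPolynomial τ ℤ) : ℕ :=
  ∑ i, (f i).totalDegree

/-- The `i`-th Minkowski successive minimum of `𝓞 K`: the smallest `t` such that the integers
`α` with `‖α‖ ≤ t` span a space of dimension at least `i`. Here `‖α‖`, the maximum of `|α|_v` over
the archimedean places `v`, is Mathlib's `NumberField.house`. -/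
def successiveMinimum (K : Type*) [Field K] [NumberField K] (i : ℕ) : ℝ :=
  sInf {t : ℝ | 0 ≤ t ∧ i ≤ Module.finrank ℚ
    (Submodule.span ℚ ((fun a : 𝓞 K => (a : K)) '' {a : 𝓞 K | NumberField.house (a : K) ≤ t}))}

/-- The largest successive minimum of `𝓞 K`. -/
def lambdaMax (K : Type*) [Field K] [NumberField K] : ℝ :=
  successiveMinimum K (Module.finrank ℚ K)

/-- The Galois group of the normal closure of `K` over `k`, as a permutation group through its
action on the `k`-embeddings of `K`, is isomorphic to the permutation group `G`. -/
def HasGaloisGroup {k Ω : Type*} [Field k] [Field Ω] [Algebra k Ω] {n : ℕ}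
    (G : Subgroup (Equiv.Perm (Fin n))) (K : IntermediateField k Ω) : Prop :=
  ∃ (e : (K →ₐ[k] IntermediateField.normalClosure k K Ω) ≃ Fin n)
    (φ : (IntermediateField.normalClosure k K Ω ≃ₐ[k] IntermediateField.normalClosure k K Ω) ≃* G),
    ∀ (σ : IntermediateField.normalClosure k K Ω ≃ₐ[k] IntermediateField.normalClosure k K Ω)
      (τ : K →ₐ[k] IntermediateField.normalClosure k K Ω),
      e (σ.toAlgHom.comp τ) = (φ σ : Equiv.Perm (Fin n)) (e τ)

/-- `𝓕_{n,k}(X; G)`: the extensions `K/k` of degree `n` inside the algebraic closure `Ω` of `k`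
with Galois group `G` and absolute discriminant at most `X` in absolute value. -/
def extensions (k Ω : Type*) [Field k] [Field Ω] [Algebra k Ω] {n : ℕ}
    (G : Subgroup (Equiv.Perm (Fin n))) (X : ℝ) : Set (IntermediateField k Ω) :=
  {K | Module.finrank k K = n ∧ HasGaloisGroup G K ∧
    ∃ _ : NumberField K, ((|NumberField.discr K| : ℤ) : ℝ) ≤ X}

/-- The fields `K` in `𝓕_{n,k}(X; G)` with `λ_max(K) ≤ l`. -/
def extensionsMinimaLE (k Ω : Type*) [Field k] [Field Ω] [Algebra k Ω] {n : ℕ}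
    (G : Subgroup (Equiv.Perm (Fin n))) (X l : ℝ) : Set (IntermediateField k Ω) :=
  {K | K ∈ extensions k Ω G X ∧ ∃ _ : NumberField K, lambdaMax K ≤ l}

/-- `(2π)^{dnr} d!^{nr} 𝓘(1)^d (2dn (deg 𝓘 + (n choose 2)))^{d deg 𝓘}`. -/
def explicitConst (n r d : ℕ) (f : Fin (n * r) → MvPolynomial (Fin r × Fin n) ℤ) : ℝ :=
  (2 * Real.pi) ^ (d * n * r) * (d.factorial : ℝ) ^ (n * r) * (evalOne f : ℝ) ^ d *
    (2 * d * n * ((degSum f : ℝ) + (n.choose 2 : ℝ))) ^ (d * degSum f)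

end InvariantBound

end

/-!
A field `K` with `λ_max(K) ≤ l` has many `r`-tuples of integers whose conjugates are `O(l)`: by the
pigeonhole principle, at least about `l ^ (dnr) / |Disc K| ^ (r / 2)` of them, and they can be
translated off any proper hypersurface at bounded cost. The conjugates of such a tuple form a point
of `(𝔸ⁿ)ʳ` at which the invariants `fᵢ` take values in `𝓞 k` of size `O(l ^ deg fᵢ)`. Counting
lattice points in `𝓞 k`, there are `O(l ^ (d deg 𝓘) / |Disc k| ^ (nr / 2))` possible values of
`(f₁, …, f_{nr})`. Since the `fᵢ` are algebraically independent, their Jacobian determinant does not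
vanish identically, and away from its zeros each value is taken at most `∏ deg fᵢ` times, by
Bézout. As a general coordinate of the point generates `K`, dividing the two counts bounds the
number of fields with `λ_max(K) ≤ l`.

The bound without `λ_max` is the case `l = X ^ (1 / dn)`: since the integers with `‖α‖ ≤ λᵢ` and
those with `‖α‖ ≤ λ_{m + 1 - i}`, `m = [K : ℚ]`, multiply to a spanning set of `K`, one has
`λ_max ≤ λᵢ λ_{m + 1 - i}`, and Minkowski's second theorem gives
`λ_max ^ m ≤ (∏ λᵢ) ^ 2 ≤ |Disc K|`.
-/

namespace InvariantBound

open MeasureTheory Module Submodule Set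

/-! ### Minkowski's second theorem -/

section FiberHomothety

variable {𝕜 E : Type*} [Field 𝕜] [AddCommGroup E] [Module 𝕜 E] {V W : Submodule 𝕜 E}

/-- The linear map that multiplies by `θ` along `V` and is the identity along its complement
`W`. -/
noncomputable def scaleAlong (h : IsCompl V W) (θ : 𝕜) : E →ₗ[𝕜] E :=
  θ • V.projection W h + W.projection V h.symm

theorem det_scaleAlong [FiniteDimensional 𝕜 E] (h : IsCompl V W) (θ : 𝕜) :
    LinearMap.det (scaleAlong h θ) = θ ^ finrank 𝕜 V := by
  have hconj : scaleAlong h θ = (V.prodEquivOfIsCompl W h : (V × W) →ₗ[𝕜] E) ∘ₗ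
      (LinearMap.prodMap (θ • LinearMap.id) LinearMap.id) ∘ₗ
        ((V.prodEquivOfIsCompl W h).symm : E →ₗ[𝕜] V × W) := by
    ext x
    obtain ⟨⟨v, w⟩, rfl⟩ := (V.prodEquivOfIsCompl W h).surjective x
    simp [scaleAlong]
  rw [hconj, LinearMap.det_conj, LinearMap.det_prodMap]
  simp

/-- The map that restricts, on each coset `w + V` with `w ∈ W`, to the homothety of ratio `θ`
centred at `w + q`. -/
noncomputable def fiberHomothety (h : IsCompl V W) (θ : 𝕜) (q : V) (x : E) : E :=
  AffineMap.homothety (W.projection V h.symm x + q : E) θ x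

theorem sub_mem_iff_projection_eq (h : IsCompl V W) {x y : E} :
    x - y ∈ V ↔ W.projection V h.symm x = W.projection V h.symm y := by
  rw [← projection_apply_eq_zero_iff h.symm, map_sub, sub_eq_zero]

theorem fiberHomothety_eq (h : IsCompl V W) (θ : 𝕜) (q : V) (x : E) :
    fiberHomothety h θ q x = (1 - θ) • (q : E) + scaleAlong h θ x := by
  have hV : V.projection W h x = x - W.projection V h.symm x :=
    projection_eq_self_sub_projection h.symm x
  simp only [fiberHomothety, scaleAlong, AffineMap.homothety_apply, vsub_eq_sub, vadd_eq_add,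
    LinearMap.add_apply, LinearMap.smul_apply, hV]
  module

theorem projection_fiberHomothety (h : IsCompl V W) (θ : 𝕜) (q : V) (x : E) :
    W.projection V h.symm (fiberHomothety h θ q x) = W.projection V h.symm x := by
  refine (sub_mem_iff_projection_eq h).1 ?_
  have : fiberHomothety h θ q x - x = (1 - θ) • ((q : E) - (x - W.projection V h.symm x)) := by
    simp only [fiberHomothety, AffineMap.homothety_apply, vsub_eq_sub, vadd_eq_add]
    module
  rw [this]
  exact V.smul_mem _ (V.sub_mem q.2 (sub_projection_mem h.symm x))

theorem fiberHomothety_sub (h : IsCompl V W) (θ : 𝕜) (q : V) {x y : E} (hxy : x - y ∈ V) :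
    fiberHomothety h θ q x - fiberHomothety h θ q y = θ • (x - y) := by
  simp only [fiberHomothety, (sub_mem_iff_projection_eq h).1 hxy, AffineMap.homothety_apply,
    vsub_eq_sub, vadd_eq_add]
  module

end FiberHomothety

section Squeeze

variable {E : Type*} [NormedAddCommGroup E] [NormedSpace ℝ E] [FiniteDimensional ℝ E]
  [MeasurableSpace E] [BorelSpace E]

theorem measure_image_fiberHomothety (μ : Measure E) [μ.IsAddHaarMeasure] {V W : Submodule ℝ E}
    (h : IsCompl V W) {θ : ℝ} (hθ : 0 ≤ θ) (q : V) (s : Set E) :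
    μ (fiberHomothety h θ q '' s) = ENNReal.ofReal (θ ^ finrank ℝ V) * μ s := by
  have himage : fiberHomothety h θ q '' s =
      (fun x => (1 - θ) • (q : E) + x) '' (scaleAlong h θ '' s) := by
    simp only [image_image, fiberHomothety_eq]
  rw [himage, image_add_left, measure_preimage_add, Measure.addHaar_image_linearMap,
    det_scaleAlong, abs_of_nonneg (pow_nonneg hθ _)]

theorem measurableSet_image_fiberHomothety {V W : Submodule ℝ E} (h : IsCompl V W) {θ : ℝ}
    (hθ : θ ≠ 0) (q : V) {s : Set E} (hs : MeasurableSet s) :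
    MeasurableSet (fiberHomothety h θ q '' s) := by
  have hdet : LinearMap.det (scaleAlong h θ) ≠ 0 := by
    rw [det_scaleAlong]
    exact pow_ne_zero _ hθ
  let e := ((scaleAlong h θ).equivOfDetNeZero hdet).toContinuousLinearEquiv.toHomeomorph.trans
    (Homeomorph.addLeft ((1 - θ) • (q : E)))
  have he : fiberHomothety h θ q = e := funext fun x => fiberHomothety_eq h θ q x
  rw [he]
  exact e.toMeasurableEquiv.measurableSet_image.2 hs

theorem exists_measurable_section {K : Set E} (hK : IsOpen K) (V : Submodule ℝ E) :
    ∃ (q : ℕ → V) (B : ℕ → Set E), Pairwise (Function.onFun Disjoint B) ∧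
      (∀ j, MeasurableSet (B j)) ∧ (∀ j, ∀ w ∈ B j, w + q j ∈ K) ∧
      ∀ w, ∀ v ∈ V, w + v ∈ K → ∃ j, w ∈ B j := by
  let q : ℕ → V := TopologicalSpace.denseSeq V
  let U : ℕ → Set E := fun j => {w | w + q j ∈ K}
  have hU : ∀ j, MeasurableSet (U j) := fun j =>
    (hK.preimage (continuous_id.add continuous_const)).measurableSet
  refine ⟨q, disjointed U, disjoint_disjointed U, fun j => .disjointed hU j,
    fun j w hw => disjointed_subset U j hw, fun w v hv hwv => ?_⟩
  have hopen : IsOpen {u : V | w + u ∈ K} :=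
    hK.preimage (continuous_const.add continuous_subtype_val)
  obtain ⟨j, hj⟩ := (TopologicalSpace.denseRange_denseSeq V).exists_mem_open hopen ⟨⟨v, hv⟩, hwv⟩
  have hw : w ∈ ⋃ j, disjointed U j := iUnion_disjointed (f := U) ▸ mem_iUnion.2 ⟨j, hj⟩
  exact mem_iUnion.1 hw

theorem exists_squeeze (μ : Measure E) [μ.IsAddHaarMeasure] {K A : Set E} (hKc : Convex ℝ K)
    (hKo : IsOpen K) (hA : MeasurableSet A) (hAK : A ⊆ K) (V : Submodule ℝ E) {θ : ℝ}
    (h0 : 0 < θ) (h1 : θ ≤ 1) :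
    ∃ A' ⊆ K, MeasurableSet A' ∧ μ A' = ENNReal.ofReal (θ ^ finrank ℝ V) * μ A ∧
      ∀ x ∈ A', ∀ y ∈ A', x - y ∈ V → ∃ a ∈ A, ∃ b ∈ A, x - y = θ • (a - b) := by
  obtain ⟨W, hW⟩ := V.exists_isCompl
  obtain ⟨q, B, hBdisj, hBmeas, hBK, hBcover⟩ := exists_measurable_section hKo V
  let ρ := W.projection V hW.symm
  let T : ℕ → E → E := fun j => fiberHomothety hW θ (q j)
  have hρT : ∀ j x, ρ (T j x) = ρ x := fun j x => projection_fiberHomothety hW θ (q j) x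
  have hindex : ∀ {i j w}, w ∈ B i → w ∈ B j → i = j := fun {i j w} hi hj => by
    by_contra hij
    exact Set.disjoint_left.1 (hBdisj hij) hi hj
  have hpieces : ∀ j, MeasurableSet (A ∩ ρ ⁻¹' B j) := fun j =>
    hA.inter (ρ.continuous_of_finiteDimensional.measurable (hBmeas j))
  have hAB : A ⊆ ⋃ j, ρ ⁻¹' B j := fun x hx => mem_iUnion.2 <|
    hBcover (ρ x) _ (sub_projection_mem hW.symm x) (by simpa [ρ] using hAK hx)
  refine ⟨⋃ j, T j '' (A ∩ ρ ⁻¹' B j), iUnion_subset fun j => ?_, .iUnion fun j =>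
    measurableSet_image_fiberHomothety hW h0.ne' (q j) (hpieces j), ?_, ?_⟩
  · rintro _ ⟨x, ⟨hxA, hxB⟩, rfl⟩
    exact hKc.lineMap_mem (hBK j _ hxB) (hAK hxA) ⟨h0.le, h1⟩
  · rw [measure_iUnion]
    · simp_rw [T, measure_image_fiberHomothety μ hW h0.le, ENNReal.tsum_mul_left]
      rw [← measure_iUnion (fun i j hij => Set.disjoint_left.2 fun x hi hj =>
        hij (hindex hi.2 hj.2)) hpieces, ← inter_iUnion, inter_eq_left.2 hAB]
    · intro i j hij
      refine Set.disjoint_left.2 ?_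
      rintro _ ⟨x, hx, rfl⟩ ⟨y, hy, hxy⟩
      refine hij (hindex hx.2 (?_ : ρ x ∈ B j))
      rw [← hρT i x, ← hxy, hρT]
      exact hy.2
    · exact fun j => measurableSet_image_fiberHomothety hW h0.ne' (q j) (hpieces j)
  · intro x hx y hy hxy
    obtain ⟨i, a, ha, rfl⟩ := mem_iUnion.1 hx
    obtain ⟨j, b, hb, rfl⟩ := mem_iUnion.1 hy
    have hab : ρ a = ρ b := by
      rw [← hρT i a, ← hρT j b]
      exact (sub_mem_iff_projection_eq hW).1 hxy
    obtain rfl : i = j := hindex (w := ρ a) ha.2 (hab ▸ hb.2)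
    exact ⟨a, ha.1, b, hb.1,
      fiberHomothety_sub hW θ (q i) ((sub_mem_iff_projection_eq hW).2 hab)⟩

end Squeeze

section MinkowskiSecond

variable {E : Type*} [NormedAddCommGroup E] [NormedSpace ℝ E] [FiniteDimensional ℝ E]
  [MeasurableSpace E] [BorelSpace E]

theorem exists_subset_norm_sub_lt (μ : Measure E) [μ.IsAddHaarMeasure] {K : Set E}
    (hKc : Convex ℝ K) (hKo : IsOpen K) {c : ℝ} (hKdiff : ∀ x ∈ K, ∀ y ∈ K, ‖x - y‖ < c)
    {l : ℕ → ℝ} (hl0 : ∀ i, 0 < l i) (hl : Monotone l) {V : ℕ → Submodule ℝ E} (hV : Monotone V)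
    (hVd : ∀ i, finrank ℝ (V i) ≤ i + 1) (j : ℕ) :
    ∃ A ⊆ K, MeasurableSet A ∧
      ENNReal.ofReal ((∏ i ∈ Finset.range j, l i) / l j ^ j) * μ K ≤ μ A ∧
      ∀ i ≤ j, ∀ x ∈ A, ∀ y ∈ A, x - y ∈ V i → ‖x - y‖ < l i * c / l j := by
  induction j with
  | zero =>
    refine ⟨K, subset_rfl, hKo.measurableSet, by simp, fun i hi x hx y hy _ => ?_⟩
    obtain rfl : i = 0 := Nat.le_zero.1 hi
    rw [mul_div_cancel_left₀ _ (hl0 0).ne']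
    exact hKdiff x hx y hy
  | succ j ih =>
    obtain ⟨A, hAK, hAm, hAμ, hA⟩ := ih
    have hθ0 : 0 < l j / l (j + 1) := div_pos (hl0 _) (hl0 _)
    have hθ1 : l j / l (j + 1) ≤ 1 := (div_le_one (hl0 _)).2 (hl j.le_succ)
    obtain ⟨A', hA'K, hA'm, hA'μ, hA'⟩ := exists_squeeze μ hKc hKo hAm hAK (V j) hθ0 hθ1
    refine ⟨A', hA'K, hA'm, ?_, fun i hi x hx y hy hxy => ?_⟩
    · have hscale : (∏ i ∈ Finset.range (j + 1), l i) / l (j + 1) ^ (j + 1) =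
          (l j / l (j + 1)) ^ (j + 1) * ((∏ i ∈ Finset.range j, l i) / l j ^ j) := by
        have hj := (hl0 j).ne'
        rw [Finset.prod_range_succ, div_pow]
        field_simp
        ring
      rw [hscale, ENNReal.ofReal_mul (by positivity), mul_assoc, hA'μ]
      gcongr ENNReal.ofReal ?_ * ?_
      exact pow_le_pow_of_le_one hθ0.le hθ1 (hVd j)
    · rcases hi.eq_or_lt with rfl | hij
      · rw [mul_div_cancel_left₀ _ (hl0 _).ne']
        exact hKdiff x (hA'K hx) y (hA'K hy)
      · have hij : i ≤ j := Nat.lt_succ_iff.1 hij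
        obtain ⟨a, ha, b, hb, hab⟩ := hA' x hx y hy (hV hij hxy)
        have hmem : a - b ∈ V i := by rwa [hab, (V i).smul_mem_iff hθ0.ne'] at hxy
        calc ‖x - y‖ = l j / l (j + 1) * ‖a - b‖ := by
              rw [hab, norm_smul, Real.norm_of_nonneg hθ0.le]
          _ < l j / l (j + 1) * (l i * c / l j) := by gcongr; exact hA i hij a ha b hb hmem
          _ = l i * c / l (j + 1) := by have hj := (hl0 j).ne'; field_simp

theorem exists_lattice_sub_mem (μ : Measure E) [μ.IsAddHaarMeasure] {L : AddSubgroup E}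
    [Countable L] {F A : Set E} (hF : IsAddFundamentalDomain L F μ) (hA : MeasurableSet A)
    (hlt : μ F < μ A) : ∃ a ∈ A, ∃ b ∈ A, a - b ∈ L ∧ a - b ≠ 0 := by
  obtain ⟨x, y, hxy, hdis⟩ :=
    exists_pair_mem_lattice_not_disjoint_vadd hF hA.nullMeasurableSet hlt
  obtain ⟨_, ⟨a, ha, rfl⟩, ⟨b, hb, hab⟩⟩ := Set.not_disjoint_iff.1 hdis
  have hsub : a - b = ((y - x : L) : E) := by
    have hab : (y : E) + b = x + a := hab
    rw [AddSubgroup.coe_sub, sub_eq_sub_iff_add_eq_add, add_comm a, ← hab, add_comm]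
  refine ⟨a, ha, b, hb, hsub ▸ (y - x).2, ?_⟩
  rw [hsub, Ne, ZeroMemClass.coe_eq_zero, sub_eq_zero]
  exact hxy.symm

/-- Minkowski's second theorem, for the successive minima `l 0 ≤ l 1 ≤ …`. If `V i` is the span of
the lattice points of norm less than `l (i + 1)`, the ball of radius `l m / 2` is squeezed along
`V 0, V 1, …` in turn until no two of its points differ by a nonzero lattice point. -/
theorem prod_mul_measure_ball_le [Nontrivial E] (μ : Measure E) [μ.IsAddHaarMeasure]
    {L : AddSubgroup E} [Countable L] {F : Set E} (hF : IsAddFundamentalDomain L F μ) {l : ℕ → ℝ}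
    (hl0 : ∀ i, 0 < l i) (hl : Monotone l)
    (h : ∀ i < finrank ℝ E, finrank ℝ (span ℝ {x : E | x ∈ L ∧ ‖x‖ < l i}) ≤ i) :
    ENNReal.ofReal (∏ i ∈ Finset.range (finrank ℝ E), l i) * μ (Metric.ball 0 (1 / 2)) ≤ μ F := by
  obtain ⟨m, hm⟩ : ∃ m, finrank ℝ E = m + 1 := Nat.exists_eq_succ_of_ne_zero finrank_pos.ne'
  rw [hm] at h ⊢
  set K : Set E := Metric.ball 0 (l m * (1 / 2)) with hK
  have hKdiff : ∀ x ∈ K, ∀ y ∈ K, ‖x - y‖ < l m := fun x hx y hy => by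
    rw [hK, mem_ball_zero_iff] at hx hy
    linarith [norm_sub_le x y]
  let V : ℕ → Submodule ℝ E := fun i => span ℝ {x | x ∈ L ∧ ‖x‖ < l (i + 1)}
  have hV : Monotone V := fun i j hij =>
    span_mono fun x hx => ⟨hx.1, hx.2.trans_le (hl (Nat.succ_le_succ hij))⟩
  have hVd : ∀ i, finrank ℝ (V i) ≤ i + 1 := fun i =>
    (lt_or_ge i m).elim (fun him => h (i + 1) (by lia))
      fun him => (finrank_le _).trans (by lia)
  obtain ⟨A, hAK, hAm, hAμ, hA⟩ := exists_subset_norm_sub_lt μ (convex_ball 0 _)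
    Metric.isOpen_ball hKdiff hl0 hl hV hVd m
  have hvol : ENNReal.ofReal (∏ i ∈ Finset.range (m + 1), l i) * μ (Metric.ball 0 (1 / 2)) =
      ENNReal.ofReal ((∏ i ∈ Finset.range m, l i) / l m ^ m) * μ K := by
    have hlm := (hl0 m).ne'
    have hnonneg : 0 ≤ (∏ i ∈ Finset.range m, l i) / l m ^ m :=
      div_nonneg (Finset.prod_nonneg fun i _ => (hl0 i).le) (pow_nonneg (hl0 m).le _)
    rw [hK, Measure.addHaar_ball_mul_of_pos μ _ (hl0 m), hm, ← mul_assoc,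
      ← ENNReal.ofReal_mul hnonneg, Finset.prod_range_succ]
    congr 2
    field_simp
    ring
  rw [hvol]
  refine hAμ.trans ?_
  by_contra! hlt
  obtain ⟨a, ha, b, hb, hL, hne⟩ := exists_lattice_sub_mem μ hF hAm hlt
  have hdescent : ∀ i ≤ m, ‖a - b‖ < l i := fun i hi => by
    induction hi using Nat.decreasingInduction with
    | self => exact hKdiff a (hAK ha) b (hAK hb)
    | of_succ i hi ih =>
      have := hA i hi.le a ha b hb (subset_span ⟨hL, ih⟩)
      rwa [mul_div_cancel_right₀ _ (hl0 m).ne'] at this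
  have hspan : span ℝ {x : E | x ∈ L ∧ ‖x‖ < l 0} = ⊥ :=
    finrank_eq_zero.1 (Nat.le_zero.1 (h 0 m.succ_pos))
  exact hne (span_eq_bot.1 hspan _ ⟨hL, hdescent 0 m.zero_le⟩)

end MinkowskiSecond

section LatticePoints

variable {E : Type*} [NormedAddCommGroup E] [MeasurableSpace E] [BorelSpace E] (μ : Measure E)
  [μ.IsAddLeftInvariant] {L : AddSubgroup E} [Countable L] {F : Set E}

theorem setLIntegral_tsum_indicator_add (hF : IsAddFundamentalDomain L F μ) {s : Set E}
    (hs : MeasurableSet s) : ∫⁻ x in F, ∑' g : L, s.indicator 1 ((g : E) + x) ∂μ = μ s := by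
  rw [← lintegral_indicator_one hs, hF.lintegral_eq_tsum'', lintegral_tsum]
  · rfl
  · exact fun g => ((measurable_one.indicator hs).comp (measurable_const_add _)).aemeasurable

theorem measure_ball_le_card_mul (hF : IsAddFundamentalDomain L F μ) {R : ℝ} (S : Finset L)
    (hS : ∀ x : L, ‖(x : E)‖ ≤ R → x ∈ S) : μ (Metric.ball 0 (R / 2)) ≤ S.card * μ F := by
  have hcount (x : E) :
      ∑' g : L, (Metric.ball (0 : E) (R / 2)).indicator (1 : E → ENNReal) (g + x) ≤ S.card := by
    by_cases hx : ∃ g₀ : L, (g₀ : E) + x ∈ Metric.ball (0 : E) (R / 2)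
    · obtain ⟨g₀, hg₀⟩ := hx
      rw [← (Equiv.addRight g₀).tsum_eq, tsum_eq_sum (s := S)]
      · refine (Finset.sum_le_card_nsmul _ _ 1 fun g _ => ?_).trans (by simp)
        exact (Set.indicator_le_self' (by simp) _).trans (by simp)
      · refine fun g hg => Set.indicator_of_notMem (fun hmem => hg (hS g ?_)) _
        rw [mem_ball_zero_iff] at hg₀ hmem
        calc ‖(g : E)‖ = ‖((Equiv.addRight g₀ g : L) : E) + x - ((g₀ : E) + x)‖ := by simp
          _ ≤ R := (norm_sub_le _ _).trans (by linarith)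
    · push Not at hx
      simp [tsum_congr fun g : L => Set.indicator_of_notMem (hx g) (1 : E → ENNReal)]
  rw [← setLIntegral_tsum_indicator_add μ hF Metric.isOpen_ball.measurableSet]
  exact (lintegral_mono hcount).trans_eq (by simp)

theorem card_mul_le_measure_closedBall (hF : IsAddFundamentalDomain L F μ) {R ρ : ℝ}
    (hρ : ∀ x : E, ∃ g : L, ‖(g : E) + x‖ ≤ ρ) (S : Finset L) (hS : ∀ x ∈ S, ‖(x : E)‖ ≤ R) :
    S.card * μ F ≤ μ (Metric.closedBall 0 (R + ρ)) := by
  have hcount (x : E) : (S.card : ENNReal) ≤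
      ∑' g : L, (Metric.closedBall (0 : E) (R + ρ)).indicator 1 ((g : E) + x) := by
    obtain ⟨g₀, hg₀⟩ := hρ x
    have hmem : ∀ g ∈ S, ((Equiv.addRight g₀ g : L) : E) + x ∈ Metric.closedBall 0 (R + ρ) := by
      intro g hg
      rw [mem_closedBall_zero_iff, Equiv.coe_addRight, AddSubgroup.coe_add, add_assoc]
      exact (norm_add_le _ _).trans (add_le_add (hS g hg) hg₀)
    rw [← (Equiv.addRight g₀).tsum_eq]
    refine le_trans (le_of_eq ?_) (ENNReal.sum_le_tsum S)
    rw [Finset.sum_congr rfl fun g hg => Set.indicator_of_mem (hmem g hg) _]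
    simp
  rw [← setLIntegral_tsum_indicator_add μ hF Metric.isClosed_closedBall.measurableSet]
  exact le_of_eq_of_le (by simp) (lintegral_mono hcount)

end LatticePoints

/-! ### Integers of bounded house -/

open NumberField NumberField.mixedEmbedding NumberField.InfinitePlace

section HouseSpan

theorem exists_basis_mem_of_span_eq_top {F V : Type*} [DivisionRing F] [AddCommGroup V] [Module F V]
    [FiniteDimensional F V] {s : Set V} (hs : span F s = ⊤) :
    ∃ b : Basis (Fin (finrank F V)) F V, ∀ i, b i ∈ s := by
  let b := Basis.ofSpan hs.ge
  have := FiniteDimensional.fintypeBasisIndex b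
  let e := Fintype.equivFinOfCardEq (finrank_eq_card_basis b).symm
  exact ⟨b.reindex e, fun i => by
    rw [Basis.reindex_apply]
    exact Basis.ofSpan_subset hs.ge ⟨e.symm i, rfl⟩⟩

theorem finrank_le_finrank_dualAnnihilator {F L : Type*} [Field F] [Field L] [Algebra F L]
    [FiniteDimensional F L] {U V : Submodule F L} {φ : Dual F L} (hφ0 : φ ≠ 0)
    (hφ : U * V ≤ LinearMap.ker φ) : finrank F U ≤ finrank F V.dualAnnihilator := by
  let ψ : L →ₗ[F] Dual F L := (LinearMap.mul F L).compr₂ φ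
  have hψ_apply (x y : L) : ψ x y = φ (x * y) := rfl
  have hψ : Function.Injective ψ := by
    refine (injective_iff_map_eq_zero ψ).2 fun x hx => ?_
    by_contra hx0
    refine hφ0 (LinearMap.ext fun z => ?_)
    have hz : ψ x (x⁻¹ * z) = 0 := by rw [hx, LinearMap.zero_apply]
    rwa [hψ_apply, mul_inv_cancel_left₀ hx0] at hz
  have hU : U.map ψ ≤ V.dualAnnihilator := by
    rintro _ ⟨u, hu, rfl⟩
    refine (mem_dualAnnihilator _).2 fun v hv => ?_
    rw [hψ_apply]
    exact hφ (mul_mem_mul hu hv)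
  exact (U.equivMapOfInjective ψ hψ).finrank_eq.trans_le (Submodule.finrank_mono hU)

theorem mul_eq_top_of_finrank_lt {F L : Type*} [Field F] [Field L] [Algebra F L]
    [FiniteDimensional F L] {U V : Submodule F L} (h : finrank F L < finrank F U + finrank F V) :
    U * V = ⊤ := by
  by_contra hne
  obtain ⟨φ, hφ0, hφ⟩ := (U * V).exists_le_ker_of_lt_top (lt_top_iff_ne_top.2 hne)
  have hle := finrank_le_finrank_dualAnnihilator hφ0 hφ
  have hadd := Subspace.finrank_add_finrank_dualAnnihilator_eq V
  lia

variable (K : Type*) [Field K] [NumberField K]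

theorem finite_house_le (R : ℝ) : {a : 𝓞 K | house (a : K) ≤ R}.Finite := by
  refine Set.Finite.of_injOn (f := fun a : 𝓞 K => (a : K)) (t := {x : K | IsIntegral ℤ x ∧
    ∀ φ : K →+* ℂ, ‖φ x‖ ≤ R}) (fun a ha => ?_) RingOfIntegers.coe_injective.injOn
    (Embeddings.finite_of_norm_le K ℂ R)
  exact ⟨a.isIntegral_coe, (canonicalEmbedding.norm_le_iff _ _).1 ha⟩

theorem exists_gt_forall_house_le (t : ℝ) :
    ∃ u > t, ∀ a : 𝓞 K, house (a : K) < u → house (a : K) ≤ t := by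
  by_cases hne : {a : 𝓞 K | house (a : K) ≤ t + 1 ∧ t < house (a : K)}.Nonempty
  · obtain ⟨a, ha, hmin⟩ := Set.exists_min_image _ (fun a : 𝓞 K => house (a : K))
      (show {a : 𝓞 K | house (a : K) ≤ t + 1 ∧ t < house (a : K)}.Finite from
        (finite_house_le K (t + 1)).inter_of_left _) hne
    refine ⟨house (a : K), ha.2, fun x hx => ?_⟩
    by_contra! hlt
    exact (hmin x ⟨hx.le.trans ha.1, hlt⟩).not_gt hx
  · refine ⟨t + 1, lt_add_one t, fun x hx => ?_⟩
    by_contra! hlt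
    exact hne ⟨x, hx.le, hlt⟩

theorem exists_lt_forall_house_le {u : ℝ} (hu : 0 < u) :
    ∃ t < u, 0 ≤ t ∧ ∀ a : 𝓞 K, house (a : K) < u → house (a : K) ≤ t := by
  obtain ⟨a, ha, hmax⟩ := Set.exists_max_image {a : 𝓞 K | house (a : K) < u}
    (fun a => house (a : K)) ((finite_house_le K u).subset fun a => le_of_lt (a := house (a : K)))
    ⟨0, by simpa [house] using hu⟩
  exact ⟨house (a : K), ha, house_nonneg _, hmax⟩

/-- The `ℚ`-span of the algebraic integers of `K` all of whose conjugates have absolute value at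
most `t`; the successive minima of `𝓞 K` are the values of `t` at which it grows. -/
def houseSpan (t : ℝ) : Submodule ℚ K :=
  span ℚ ((fun a : 𝓞 K => (a : K)) '' {a | house (a : K) ≤ t})

variable {K}

theorem coe_mem_houseSpan {a : 𝓞 K} {t : ℝ} (ha : house (a : K) ≤ t) : (a : K) ∈ houseSpan K t :=
  subset_span ⟨a, ha, rfl⟩

theorem houseSpan_mono : Monotone (houseSpan K) := fun _ _ h =>
  span_mono (image_mono fun _ ha => le_trans ha h)

theorem houseSpan_mul_le (s t : ℝ) : houseSpan K s * houseSpan K t ≤ houseSpan K (s * t) := by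
  rw [houseSpan, houseSpan, span_mul_span, span_le]
  rintro _ ⟨_, ⟨a, ha, rfl⟩, _, ⟨b, hb, rfl⟩, rfl⟩
  exact coe_mem_houseSpan (a := a * b) <| (house_mul_le _ _).trans <|
    mul_le_mul ha hb (house_nonneg _) ((house_nonneg _).trans ha)

variable (K) in
theorem exists_houseSpan_eq_top : ∃ t, 0 ≤ t ∧ houseSpan K t = ⊤ := by
  refine ⟨∑ i, house (integralBasis K i), Finset.sum_nonneg fun i _ => house_nonneg _, ?_⟩
  rw [eq_top_iff, ← (integralBasis K).span_eq, span_le]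
  rintro _ ⟨i, rfl⟩
  have hi : house (integralBasis K i) ≤ ∑ i, house (integralBasis K i) :=
    Finset.single_le_sum (fun i _ => house_nonneg (integralBasis K i)) (Finset.mem_univ i)
  rw [integralBasis_apply] at hi ⊢
  exact coe_mem_houseSpan hi

theorem successiveMinimum_le {i : ℕ} {t : ℝ} (ht : 0 ≤ t) (hi : i ≤ finrank ℚ (houseSpan K t)) :
    successiveMinimum K i ≤ t :=
  csInf_le ⟨0, fun _ hs => hs.1⟩ ⟨ht, hi⟩

theorem successiveMinimum_nonneg (i : ℕ) : 0 ≤ successiveMinimum K i :=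
  Real.sInf_nonneg fun _ ht => ht.1

theorem le_finrank_houseSpan {i : ℕ} (hi : i ≤ finrank ℚ K) :
    i ≤ finrank ℚ (houseSpan K (successiveMinimum K i)) := by
  obtain ⟨t₀, ht₀, htop⟩ := exists_houseSpan_eq_top K
  obtain ⟨u, hu, hgap⟩ := exists_gt_forall_house_le K (successiveMinimum K i)
  obtain ⟨t, ⟨-, hit⟩, htu⟩ := exists_lt_of_csInf_lt
    (s := {t : ℝ | 0 ≤ t ∧ i ≤ finrank ℚ (houseSpan K t)})
    ⟨t₀, ht₀, by rwa [htop, finrank_top]⟩ hu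
  exact hit.trans <| Submodule.finrank_mono <| span_mono <| image_mono fun a ha =>
    hgap a (ha.trans_lt htu)

theorem successiveMinimum_mono {i j : ℕ} (hij : i ≤ j) (hj : j ≤ finrank ℚ K) :
    successiveMinimum K i ≤ successiveMinimum K j :=
  successiveMinimum_le (successiveMinimum_nonneg j) (hij.trans (le_finrank_houseSpan hj))

theorem one_le_successiveMinimum {i : ℕ} (hi0 : 0 < i) (hi : i ≤ finrank ℚ K) :
    1 ≤ successiveMinimum K i := by
  by_contra! hlt
  have hbot : houseSpan K (successiveMinimum K i) = ⊥ := by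
    rw [houseSpan, span_eq_bot]
    rintro _ ⟨a, ha, rfl⟩
    by_contra ha0
    exact ((one_le_house_of_isIntegral a.isIntegral_coe ha0).trans ha).not_gt hlt
  have := le_finrank_houseSpan hi
  rw [hbot, finrank_bot] at this
  lia

theorem houseSpan_eq_top_of_lambdaMax_le {l : ℝ} (hl : lambdaMax K ≤ l) : houseSpan K l = ⊤ :=
  eq_top_of_finrank_eq <| le_antisymm (finrank_le _) <|
    (le_finrank_houseSpan le_rfl).trans (Submodule.finrank_mono (houseSpan_mono hl))

theorem lambdaMax_le_mul {i j : ℕ} (hi : i ≤ finrank ℚ K) (hj : j ≤ finrank ℚ K)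
    (hij : finrank ℚ K < i + j) :
    lambdaMax K ≤ successiveMinimum K i * successiveMinimum K j := by
  have htop : houseSpan K (successiveMinimum K i) * houseSpan K (successiveMinimum K j) = ⊤ :=
    mul_eq_top_of_finrank_lt <|
      hij.trans_le (add_le_add (le_finrank_houseSpan hi) (le_finrank_houseSpan hj))
  refine successiveMinimum_le (mul_nonneg (successiveMinimum_nonneg i)
    (successiveMinimum_nonneg j)) ?_
  rw [eq_top_iff.2 (htop.ge.trans (houseSpan_mul_le _ _)), finrank_top]

variable (K) in
theorem lambdaMax_pow_le_prod_sq : lambdaMax K ^ finrank ℚ K ≤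
    (∏ i ∈ Finset.range (finrank ℚ K), successiveMinimum K (i + 1)) ^ 2 := by
  rw [sq]
  nth_rw 2 [← Finset.prod_range_reflect]
  rw [← Finset.prod_mul_distrib, ← Finset.card_range (finrank ℚ K), ← Finset.prod_const,
    Finset.card_range]
  refine Finset.prod_le_prod (fun _ _ => successiveMinimum_nonneg _) fun i hi => ?_
  rw [Finset.mem_range] at hi
  exact lambdaMax_le_mul (by lia) (by lia) (by lia)

end HouseSpan

section LatticeBounds

variable (K : Type*) [Field K] [NumberField K]

open scoped Classical in
theorem norm_mixedEmbedding_eq_house (x : K) : ‖mixedEmbedding K x‖ = house x := by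
  rw [norm_eq_sup'_normAtPlace]
  refine le_antisymm (Finset.sup'_le _ _ fun w _ => ?_) ?_
  · rw [normAtPlace_apply, ← norm_embedding_eq]
    exact norm_embedding_le_house x _
  · rw [house, canonicalEmbedding.norm_le_iff]
    intro φ
    rw [← InfinitePlace.apply φ x, ← normAtPlace_apply]
    exact Finset.le_sup' (fun w => normAtPlace w (mixedEmbedding K x)) (Finset.mem_univ _)

theorem span_mixedEmbedding (s : Set K) {x : K} (hx : x ∈ span ℚ s) :
    mixedEmbedding K x ∈ span ℝ (mixedEmbedding K '' s) :=
  span_le_restrictScalars ℚ ℝ _ <|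
    apply_mem_span_image_of_mem_span (mixedEmbedding K).toRatAlgHom.toLinearMap hx

theorem finrank_span_mixedEmbedding_le (s : Set K) :
    finrank ℝ (span ℝ (mixedEmbedding K '' s)) ≤ finrank ℚ (span ℚ s) := by
  obtain ⟨b, -, hb, -⟩ := exists_fun_fin_finrank_span_eq ℚ s
  have hle : span ℝ (mixedEmbedding K '' s) ≤ span ℝ (Set.range (mixedEmbedding K ∘ b)) := by
    rw [span_le, Set.range_comp]
    rintro _ ⟨x, hx, rfl⟩
    exact span_mixedEmbedding K _ (hb.ge (subset_span hx))
  exact (Submodule.finrank_mono hle).trans ((finrank_range_le_card _).trans_eq (Fintype.card_fin _))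

theorem span_mixedEmbedding_eq_top {s : Set K} (hs : span ℚ s = ⊤) :
    span ℝ (mixedEmbedding K '' s) = ⊤ := by
  rw [eq_top_iff, ← (latticeBasis K).span_eq, span_le]
  rintro _ ⟨i, rfl⟩
  rw [latticeBasis_apply]
  exact span_mixedEmbedding K s (hs ▸ mem_top)

open scoped Classical in
theorem ball_eq_convexBodyLT {R : NNReal} (hR : 0 < R) :
    Metric.ball (0 : mixedSpace K) R = convexBodyLT K (fun _ => R) := by
  rw [← Prod.mk_zero_zero, ← ball_prod_same, ball_pi _ (by simpa using hR),
    ball_pi _ (by simpa using hR)]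
  rfl

open scoped Classical in
theorem volume_ball_mixedSpace {R : ℝ} (hR : 0 < R) :
    volume (Metric.ball (0 : mixedSpace K) R) =
      ENNReal.ofReal (2 ^ nrRealPlaces K * Real.pi ^ nrComplexPlaces K * R ^ finrank ℚ K) := by
  lift R to NNReal using hR.le
  rw [ball_eq_convexBodyLT K (by simpa using hR), convexBodyLT_volume, Finset.prod_pow_eq_pow_sum,
    sum_mult_eq, convexBodyLTFactor, ← ENNReal.ofReal_coe_nnreal, ← ENNReal.ofReal_coe_nnreal,
    ← ENNReal.ofReal_mul (by positivity)]
  simp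

open scoped Classical in
theorem volume_ball_mul_sqrt_discr {R : ℝ} (hR : 0 < R) :
    volume (Metric.ball (0 : mixedSpace K) R) * ENNReal.ofReal √((|discr K| : ℤ) : ℝ) =
      ENNReal.ofReal (2 ^ nrRealPlaces K * (2 * Real.pi) ^ nrComplexPlaces K * R ^ finrank ℚ K) *
        volume (ZSpan.fundamentalDomain (latticeBasis K)) := by
  have hF : volume (ZSpan.fundamentalDomain (latticeBasis K)) =
      ENNReal.ofReal (2⁻¹ ^ nrComplexPlaces K * √((|discr K| : ℤ) : ℝ)) := by
    rw [volume_fundamentalDomain_latticeBasis, ← ENNReal.ofReal_coe_nnreal,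
      ENNReal.ofReal_mul (by positivity), ENNReal.ofReal_pow (by positivity),
      ENNReal.ofReal_inv_of_pos (by norm_num)]
    simp [Int.norm_eq_abs]
  rw [hF, volume_ball_mixedSpace K hR, ← ENNReal.ofReal_mul (by positivity),
    ← ENNReal.ofReal_mul (by positivity), mul_pow, inv_pow]
  congr 1
  field_simp

open scoped Classical in
theorem pow_mul_volume_le {R : ℝ} (hR : 0 < R) :
    ENNReal.ofReal (R ^ finrank ℚ K) * volume (ZSpan.fundamentalDomain (latticeBasis K)) ≤
      volume (Metric.ball (0 : mixedSpace K) (R / 2)) *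
        ENNReal.ofReal √((|discr K| : ℤ) : ℝ) := by
  have hfactor : (2 : ℝ) ^ finrank ℚ K ≤
      2 ^ nrRealPlaces K * (2 * Real.pi) ^ nrComplexPlaces K := by
    rw [← card_add_two_mul_card_eq_rank, pow_add, pow_mul]
    gcongr
    linarith [Real.two_le_pi]
  rw [volume_ball_mul_sqrt_discr K (half_pos hR)]
  gcongr ENNReal.ofReal ?_ * _
  calc R ^ finrank ℚ K = 2 ^ finrank ℚ K * (R / 2) ^ finrank ℚ K := by
        rw [← mul_pow, mul_div_cancel₀ _ two_ne_zero]
    _ ≤ _ := by gcongr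

open scoped Classical in
theorem volume_closedBall_mul_le {R : ℝ} (hR : 0 < R) :
    volume (Metric.closedBall (0 : mixedSpace K) R) * ENNReal.ofReal √((|discr K| : ℤ) : ℝ) ≤
      ENNReal.ofReal (Real.pi ^ finrank ℚ K * R ^ finrank ℚ K) *
        volume (ZSpan.fundamentalDomain (latticeBasis K)) := by
  have hfactor : 2 ^ nrRealPlaces K * (2 * Real.pi) ^ nrComplexPlaces K ≤
      Real.pi ^ finrank ℚ K := by
    rw [← card_add_two_mul_card_eq_rank, pow_add, pow_mul]
    gcongr
    · exact Real.two_le_pi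
    · nlinarith [Real.two_le_pi]
  rw [Measure.addHaar_closedBall_eq_addHaar_ball, volume_ball_mul_sqrt_discr K hR]
  gcongr

/-- The ring of integers in bijection with its image in the mixed space. -/
noncomputable def integerLatticeEquiv : 𝓞 K ≃ (mixedEmbedding.integerLattice K).toAddSubgroup :=
  (LinearEquiv.ofInjective _
    ((mixedEmbedding K).injective.comp RingOfIntegers.coe_injective)).toEquiv

open scoped Classical in
theorem norm_integerLatticeEquiv (a : 𝓞 K) :
    ‖(integerLatticeEquiv K a : mixedSpace K)‖ = house (a : K) :=
  norm_mixedEmbedding_eq_house K a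

open scoped Classical in
theorem countable_integerLattice :
    Countable (mixedEmbedding.integerLattice K).toAddSubgroup :=
  inferInstanceAs (Countable (mixedEmbedding.integerLattice K))

open scoped Classical in
theorem le_of_ofReal_mul_volume_le {x y : ℝ} (hy : 0 ≤ y)
    (h : ENNReal.ofReal x * volume (ZSpan.fundamentalDomain (latticeBasis K)) ≤
      ENNReal.ofReal y * volume (ZSpan.fundamentalDomain (latticeBasis K))) : x ≤ y :=
  (ENNReal.ofReal_le_ofReal_iff hy).1 <| (ENNReal.mul_le_mul_iff_left
    (ZSpan.measure_fundamentalDomain_ne_zero _)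
    (ZSpan.fundamentalDomain_isBounded _).measure_lt_top.ne).1 h

open scoped Classical in
theorem pow_finrank_le_ncard_mul_sqrt_discr {R : ℝ} (hR : 0 < R) :
    R ^ finrank ℚ K ≤ {a : 𝓞 K | house (a : K) ≤ R}.ncard * √((|discr K| : ℤ) : ℝ) := by
  have := countable_integerLattice K
  have hfin := finite_house_le K R
  have hcount : volume (Metric.ball (0 : mixedSpace K) (R / 2)) ≤
      {a : 𝓞 K | house (a : K) ≤ R}.ncard *
        volume (ZSpan.fundamentalDomain (latticeBasis K)) := by
    rw [Set.ncard_eq_toFinset_card _ hfin, ← Finset.card_map (integerLatticeEquiv K).toEmbedding]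
    refine measure_ball_le_card_mul volume (fundamentalDomain_integerLattice K) _ fun x hx => ?_
    obtain ⟨a, rfl⟩ := (integerLatticeEquiv K).surjective x
    rw [norm_integerLatticeEquiv] at hx
    simpa using hx
  refine le_of_ofReal_mul_volume_le K (by positivity) ((pow_mul_volume_le K hR).trans ?_)
  rw [ENNReal.ofReal_mul (by positivity), ENNReal.ofReal_natCast, mul_right_comm]
  gcongr

variable {K} in
open scoped Classical in
theorem exists_norm_add_le {B : ℝ} (hB : houseSpan K B = ⊤) (x : mixedSpace K) :
    ∃ g : (mixedEmbedding.integerLattice K).toAddSubgroup,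
      ‖(g : mixedSpace K) + x‖ ≤ finrank ℚ K * B := by
  obtain ⟨b, hb⟩ := exists_basis_mem_of_span_eq_top hB
  choose a ha hab using hb
  have hx : x ∈ span ℝ (Set.range fun i => mixedEmbedding K (a i : K)) := by
    have hrange : (Set.range fun i => mixedEmbedding K (a i : K)) =
        mixedEmbedding K '' Set.range b := by
      rw [← Set.range_comp]
      exact congrArg Set.range (funext fun i => congrArg (mixedEmbedding K) (hab i))
    rw [hrange, span_mixedEmbedding_eq_top K b.span_eq]
    exact mem_top
  obtain ⟨c, rfl⟩ := (mem_span_range_iff_exists_fun ℝ).1 hx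
  refine ⟨integerLatticeEquiv K (- ∑ i, ⌊c i⌋ • a i), ?_⟩
  have hfract : (integerLatticeEquiv K (- ∑ i, ⌊c i⌋ • a i) : mixedSpace K) +
      ∑ i, c i • mixedEmbedding K (a i : K) =
        ∑ i, Int.fract (c i) • mixedEmbedding K (a i : K) := by
    change mixedEmbedding K ((- ∑ i, ⌊c i⌋ • a i : 𝓞 K) : K) + _ = _
    simp only [map_neg, map_sum, map_zsmul, ← Int.self_sub_floor, sub_smul, Finset.sum_sub_distrib,
      Int.cast_smul_eq_zsmul]
    abel
  rw [hfract]
  calc ‖∑ i, Int.fract (c i) • mixedEmbedding K (a i : K)‖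
      ≤ ∑ i, ‖Int.fract (c i) • mixedEmbedding K (a i : K)‖ := norm_sum_le _ _
    _ ≤ ∑ _i : Fin (finrank ℚ K), B := by
        refine Finset.sum_le_sum fun i _ => ?_
        rw [_root_.norm_smul, Real.norm_of_nonneg (Int.fract_nonneg _),
          norm_mixedEmbedding_eq_house]
        exact (mul_le_of_le_one_left (house_nonneg _) (Int.fract_lt_one _).le).trans (ha i)
    _ = finrank ℚ K * B := by simp

open scoped Classical in
theorem ncard_mul_sqrt_discr_le {B R : ℝ} (hB : houseSpan K B = ⊤) (hR : 0 < R)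
    (hBR : finrank ℚ K * B ≤ R) :
    {a : 𝓞 K | house (a : K) ≤ R}.ncard * √((|discr K| : ℤ) : ℝ) ≤
      (2 * Real.pi) ^ finrank ℚ K * R ^ finrank ℚ K := by
  have := countable_integerLattice K
  have hfin := finite_house_le K R
  have hcount : {a : 𝓞 K | house (a : K) ≤ R}.ncard *
      volume (ZSpan.fundamentalDomain (latticeBasis K)) ≤
        volume (Metric.closedBall (0 : mixedSpace K) (2 * R)) := by
    rw [Set.ncard_eq_toFinset_card _ hfin, ← Finset.card_map (integerLatticeEquiv K).toEmbedding]
    refine (card_mul_le_measure_closedBall volume (fundamentalDomain_integerLattice K) (R := R)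
      (exists_norm_add_le hB) _ fun x hx => ?_).trans
        (measure_mono (Metric.closedBall_subset_closedBall (by linarith)))
    obtain ⟨a, rfl⟩ := (integerLatticeEquiv K).surjective x
    rw [norm_integerLatticeEquiv]
    simpa using hx
  refine le_of_ofReal_mul_volume_le K (by positivity) ?_
  calc _ = {a : 𝓞 K | house (a : K) ≤ R}.ncard *
        volume (ZSpan.fundamentalDomain (latticeBasis K)) *
          ENNReal.ofReal √((|discr K| : ℤ) : ℝ) := by
        rw [ENNReal.ofReal_mul (by positivity), ENNReal.ofReal_natCast, mul_right_comm]
    _ ≤ volume (Metric.closedBall (0 : mixedSpace K) (2 * R)) *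
          ENNReal.ofReal √((|discr K| : ℤ) : ℝ) := by gcongr
    _ ≤ _ := volume_closedBall_mul_le K (by positivity)
    _ = _ := by rw [mul_pow 2 R, mul_pow 2 Real.pi, mul_left_comm, mul_assoc]

open scoped Classical in
theorem finrank_span_norm_lt_successiveMinimum_le {i : ℕ} (hi : i < finrank ℚ K) :
    finrank ℝ (span ℝ {x : mixedSpace K | x ∈ (mixedEmbedding.integerLattice K).toAddSubgroup ∧
      ‖x‖ < successiveMinimum K (i + 1)}) ≤ i := by
  obtain ⟨t, ht, ht0, hgap⟩ := exists_lt_forall_house_le K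
    (zero_lt_one.trans_le (one_le_successiveMinimum i.succ_pos hi))
  have hlt : finrank ℚ (houseSpan K t) ≤ i := by
    by_contra! h
    exact (successiveMinimum_le ht0 h).not_gt ht
  refine ((Submodule.finrank_mono (span_mono ?_)).trans
    (finrank_span_mixedEmbedding_le K _)).trans hlt
  rintro _ ⟨⟨a, rfl⟩, ha⟩
  exact ⟨a, ⟨a, hgap a ((norm_mixedEmbedding_eq_house K a).symm.trans_lt ha), rfl⟩, rfl⟩

open scoped Classical in
theorem prod_successiveMinimum_le_sqrt_discr :
    ∏ i ∈ Finset.range (finrank ℚ K), successiveMinimum K (i + 1) ≤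
      √((|discr K| : ℤ) : ℝ) := by
  have := countable_integerLattice K
  have hpos : 0 < finrank ℚ K := finrank_pos
  have hfin : finrank ℝ (mixedSpace K) = finrank ℚ K := mixedEmbedding.finrank K
  let l : ℕ → ℝ := fun i => successiveMinimum K (min (i + 1) (finrank ℚ K))
  have hl : ∀ i < finrank ℚ K, l i = successiveMinimum K (i + 1) := fun i hi => by
    simp only [l, min_eq_left (Nat.succ_le_of_lt hi)]
  have hminkowski := prod_mul_measure_ball_le volume (fundamentalDomain_integerLattice K) (l := l)
    (L := (mixedEmbedding.integerLattice K).toAddSubgroup)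
    (fun i => zero_lt_one.trans_le (one_le_successiveMinimum (by lia) (min_le_right _ _)))
    (fun i j hij => successiveMinimum_mono (by lia) (min_le_right _ _))
    (fun i hi => by
      rw [hfin] at hi
      rw [hl i hi]
      exact finrank_span_norm_lt_successiveMinimum_le K hi)
  rw [hfin, Finset.prod_congr rfl fun i hi => hl i (Finset.mem_range.1 hi)] at hminkowski
  refine le_of_ofReal_mul_volume_le K (Real.sqrt_nonneg _) ?_
  have hvol := pow_mul_volume_le K one_pos
  rw [one_pow, ENNReal.ofReal_one, one_mul] at hvol
  refine (mul_le_mul_right hvol _).trans ?_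
  rw [← mul_assoc, mul_comm]
  gcongr

theorem lambdaMax_pow_le_discr : lambdaMax K ^ finrank ℚ K ≤ ((|discr K| : ℤ) : ℝ) := by
  calc lambdaMax K ^ finrank ℚ K
      ≤ (∏ i ∈ Finset.range (finrank ℚ K), successiveMinimum K (i + 1)) ^ 2 :=
        lambdaMax_pow_le_prod_sq K
    _ ≤ √((|discr K| : ℤ) : ℝ) ^ 2 := by
        gcongr
        · exact Finset.prod_nonneg fun _ _ => successiveMinimum_nonneg _
        · exact prod_successiveMinimum_le_sqrt_discr K
    _ = _ := Real.sq_sqrt (by positivity)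

end LatticeBounds

end InvariantBound

namespace InvariantBound

open MvPolynomial

/-! ### Bézout's bound and the Jacobian criterion -/

section Lines

variable {ι σ R : Type*} [CommSemiring R]

/-- The Jacobian matrix of a family of polynomials. -/
noncomputable def jacobian (f : ι → MvPolynomial σ R) : Matrix ι σ (MvPolynomial σ R) :=
  Matrix.of fun i j => pderiv j (f i)

/-- The restriction of polynomials to the line through `s` in the direction `v`. -/
noncomputable def restrictLine (s v : σ → R) : MvPolynomial σ R →ₐ[R] Polynomial R :=
  aeval fun j => Polynomial.C (s j) + Polynomial.C (v j) * Polynomial.X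

theorem coeff_zero_restrictLine (s v : σ → R) (p : MvPolynomial σ R) :
    (restrictLine s v p).coeff 0 = eval s p := by
  induction p using MvPolynomial.induction_on with
  | C a => simp [restrictLine]
  | add p q hp hq => simp [hp, hq]
  | mul_X p i hp =>
    rw [map_mul, Polynomial.mul_coeff_zero, hp, map_mul]
    simp [restrictLine]

variable [Fintype σ]

theorem coeff_one_restrictLine (s v : σ → R) (p : MvPolynomial σ R) :
    (restrictLine s v p).coeff 1 = ∑ j, eval s (pderiv j p) * v j := by
  classical
  induction p using MvPolynomial.induction_on with
  | C a => simp [restrictLine]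
  | add p q hp hq => simp [hp, hq, add_mul, Finset.sum_add_distrib]
  | mul_X p i hp =>
    have hX : restrictLine s v (X i) = Polynomial.C (s i) + Polynomial.C (v i) * Polynomial.X := by
      simp [restrictLine]
    rw [map_mul, hX, mul_add, Polynomial.coeff_add, Polynomial.coeff_mul_C, ← mul_assoc,
      Polynomial.coeff_mul_X, Polynomial.coeff_mul_C, hp, coeff_zero_restrictLine]
    simp only [Derivation.leibniz, smul_eq_mul, pderiv_X, map_add, map_mul, eval_X, add_mul,
      Finset.sum_add_distrib, Pi.single_apply]
    rw [add_comm, Finset.sum_mul]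
    congr 1
    · simp
    · exact Finset.sum_congr rfl fun j _ => by ring

theorem exists_restrictLine_eq_X_mul {f : ι → MvPolynomial σ R} {s : σ → R}
    (hs : ∀ i, eval s (f i) = 0) (v : σ → R) (i : ι) :
    ∃ u : Polynomial R, restrictLine s v (f i) = Polynomial.X * u ∧
      u.coeff 0 = ((jacobian f).map (eval s)).mulVec v i := by
  obtain ⟨u, hu⟩ := Polynomial.X_dvd_iff.2 ((coeff_zero_restrictLine s v (f i)).trans (hs i))
  refine ⟨u, hu, ?_⟩
  rw [← Polynomial.coeff_X_mul, ← hu, coeff_one_restrictLine]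
  rfl

theorem coeff_restrictLine_prod_pow_mul [Fintype ι] {f : ι → MvPolynomial σ R} {s : σ → R}
    (hs : ∀ i, eval s (f i) = 0) (v : σ → R) (a : ι → ℕ) (g : MvPolynomial σ R) {e : ℕ}
    (he : e ≤ ∑ i, a i) :
    (restrictLine s v ((∏ i, f i ^ a i) * g)).coeff e =
      if ∑ i, a i = e then (∏ i, ((jacobian f).map (eval s)).mulVec v i ^ a i) * eval s g
      else 0 := by
  choose u hu hu0 using exists_restrictLine_eq_X_mul hs v
  have hfac : restrictLine s v ((∏ i, f i ^ a i) * g) =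
      Polynomial.X ^ (∑ i, a i) * ((∏ i, u i ^ a i) * restrictLine s v g) := by
    simp only [map_mul, map_prod, map_pow, hu, mul_pow, Finset.prod_mul_distrib,
      Finset.prod_pow_eq_pow_sum, mul_assoc]
  rw [hfac, Polynomial.coeff_X_pow_mul']
  split_ifs with h₁ h₂ h₂
  · rw [h₂, Nat.sub_self, Polynomial.mul_coeff_zero, coeff_zero_restrictLine,
      Polynomial.coeff_zero_prod]
    simp only [Polynomial.coeff_zero_eq_eval_zero, Polynomial.eval_pow] at hu0 ⊢
    simp only [hu0]
  · exact absurd (le_antisymm h₁ he) h₂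
  · exact absurd h₂.le h₁
  · rfl

end Lines

section NondegenerateZeros

variable {σ F : Type*} [Field F]

theorem exists_eval_eq_ite [DecidableEq (σ → F)] (S : Finset (σ → F)) (s : σ → F) :
    ∃ g : MvPolynomial σ F, ∀ t ∈ S, eval t g = if t = s then 1 else 0 := by
  have hsep (t : σ → F) (ht : t ≠ s) : ∃ g : MvPolynomial σ F, eval s g = 1 ∧ eval t g = 0 := by
    obtain ⟨j, hj⟩ := Function.ne_iff.1 ht
    refine ⟨C (s j - t j)⁻¹ * (X j - C (t j)), ?_, by simp⟩
    simp [inv_mul_cancel₀ (sub_ne_zero.2 (Ne.symm hj))]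
  choose! g hg using hsep
  refine ⟨∏ t ∈ S.erase s, g t, fun t ht => ?_⟩
  rw [map_prod]
  split_ifs with hts
  · subst hts
    exact Finset.prod_eq_one fun u hu => (hg u (Finset.ne_of_mem_erase hu)).1
  · exact Finset.prod_eq_zero (Finset.mem_erase.2 ⟨hts, ht⟩) (hg t hts).2

variable [Fintype σ]

theorem linearIndependent_prod_pow {R : Type*} [CommRing R] [IsDomain R] [Infinite R] :
    LinearIndependent R fun (a : σ → ℕ) (w : σ → R) => ∏ i, w i ^ a i := by
  classical
  rw [linearIndependent_iff']
  intro A c hc a ha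
  have hP : ∑ a ∈ A, monomial (Finsupp.equivFunOnFinite.symm a) (c a) = 0 := by
    refine MvPolynomial.funext fun w => ?_
    simpa [eval_monomial, Finsupp.prod_fintype, Finset.sum_apply] using congrFun hc w
  have hcoeff := congrArg (coeff (Finsupp.equivFunOnFinite.symm a)) hP
  simpa [coeff_sum, coeff_monomial, ha] using hcoeff

/-- Restricted to lines through the `s`-th zero, the products of least order `e` at that zero have
as leading coefficients the degree-`e` monomials in the coordinates of the direction transformed
by the Jacobian. -/
theorem linearIndependent_prod_pow_mul [DecidableEq σ] [Infinite F] {κ : Type*}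
    {f : σ → MvPolynomial σ F} {z : κ → σ → F} (hz : ∀ s i, eval (z s) (f i) = 0)
    (hJ : ∀ s, eval (z s) (jacobian f).det ≠ 0)
    {g : κ → MvPolynomial σ F} (hg : ∀ s t, eval (z s) (g t) ≠ 0 ↔ s = t) :
    LinearIndependent F fun x : (σ → ℕ) × κ => (∏ i, f i ^ x.1 i) * g x.2 := by
  classical
  rw [linearIndependent_iff']
  intro A c hc
  by_contra! ⟨x, hx, hcx⟩
  obtain ⟨⟨a₀, s⟩, hx₀, hmin⟩ := Finset.exists_min_image (A.filter fun x => c x ≠ 0)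
    (fun x => ∑ i, x.1 i) ⟨x, Finset.mem_filter.2 ⟨hx, hcx⟩⟩
  obtain ⟨hx₀A, hcx₀⟩ := Finset.mem_filter.1 hx₀
  set e := ∑ i, a₀ i
  set J := (jacobian f).map (eval (z s))
  let c' (x : (σ → ℕ) × κ) : F := if ∑ i, x.1 i = e then c x * eval (z s) (g x.2) else 0
  have hsum (v : σ → F) : ∑ x ∈ A, c' x * ∏ i, J.mulVec v i ^ x.1 i = 0 := by
    have hcoeff := congrArg (fun p => (restrictLine (z s) v p).coeff e) hc
    simp only [map_sum, map_smul, Polynomial.finsetSum_coeff, Polynomial.coeff_smul, smul_eq_mul,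
      map_zero, Polynomial.coeff_zero] at hcoeff
    rw [← hcoeff]
    refine Finset.sum_congr rfl fun x hx => ?_
    by_cases hcx : c x = 0
    · simp [c', hcx]
    rw [coeff_restrictLine_prod_pow_mul (hz s) v x.1 (g x.2)
      (hmin x (Finset.mem_filter.2 ⟨hx, hcx⟩))]
    simp only [c']
    split_ifs <;> ring
  have hJdet : IsUnit J.det := by
    rw [isUnit_iff_ne_zero]
    exact (RingHom.map_det (eval (z s)) (jacobian f)).symm.trans_ne (hJ s)
  have hmono : ∑ a ∈ A.preimage (·, s) (Prod.mk_left_injective s).injOn,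
      c' (a, s) • (fun w : σ → F => ∏ i, w i ^ a i) = 0 := by
    funext w
    have hw : J.mulVec (J⁻¹.mulVec w) = w := by
      rw [Matrix.mulVec_mulVec, Matrix.mul_nonsing_inv _ hJdet, Matrix.one_mulVec]
    rw [Pi.zero_apply, ← hsum (J⁻¹.mulVec w), hw, Finset.sum_apply]
    refine Finset.sum_preimage _ A _ (fun x => c' x * ∏ i, w i ^ x.1 i) fun x _ hxs => ?_
    have hne : s ≠ x.2 := fun h => hxs ⟨x.1, by rw [h]⟩
    simp [c', not_not.1 (mt (hg s x.2).1 hne)]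
  have hzero : c' (a₀, s) = 0 := linearIndependent_iff'.1 (linearIndependent_prod_pow (R := F)) _
    (fun a => c' (a, s)) hmono a₀ (Finset.mem_preimage.2 hx₀A)
  exact mul_ne_zero hcx₀ ((hg s s).2 rfl) ((if_pos rfl).symm.trans hzero)

/-- The exponent vectors `a` of weighted degree `∑ aᵢ dᵢ` at most `T`. Bounding the entries by `T`
only serves to get a `Finset`; it is automatic when all weights are positive. -/
def weightedSimplex [DecidableEq σ] (d : σ → ℕ) (T : ℕ) : Finset (σ → ℕ) :=
  (Fintype.piFinset fun _ => Finset.range (T + 1)).filter fun a => ∑ i, a i * d i ≤ T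

variable [DecidableEq σ]

theorem mem_weightedSimplex {d : σ → ℕ} (hd : ∀ i, 0 < d i) {T : ℕ} {a : σ → ℕ} :
    a ∈ weightedSimplex d T ↔ ∑ i, a i * d i ≤ T := by
  rw [weightedSimplex, Finset.mem_filter, Fintype.mem_piFinset, and_iff_right_iff_imp]
  intro h i
  rw [Finset.mem_range, Nat.lt_succ_iff]
  calc a i ≤ a i * d i := Nat.le_mul_of_pos_right _ (hd i)
    _ ≤ ∑ i, a i * d i :=
      Finset.single_le_sum (f := fun i => a i * d i) (fun _ _ => Nat.zero_le _) (Finset.mem_univ i)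
    _ ≤ T := h

theorem card_weightedSimplex_le (d : σ → ℕ) (T : ℕ) :
    (weightedSimplex d T).card ≤ (T + 1) ^ Fintype.card σ := by
  rw [weightedSimplex]
  simpa using Finset.card_filter_le (Fintype.piFinset fun _ : σ => Finset.range (T + 1)) _

theorem card_weightedSimplex_one_le {d : σ → ℕ} (hd : ∀ i, 0 < d i) (T : ℕ) :
    (weightedSimplex (1 : σ → ℕ) T).card ≤ (∏ i, d i) * (weightedSimplex d T).card := by
  have hprod : ∏ i, d i = (Fintype.piFinset fun i => Finset.range (d i)).card := by simp
  rw [hprod, ← Finset.card_product]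
  refine Finset.card_le_card_of_injOn (fun b => (fun i => b i % d i, fun i => b i / d i)) ?_ ?_
  · intro b hb
    rw [Finset.mem_coe, mem_weightedSimplex (by simp)] at hb
    rw [Finset.mem_coe, Finset.mem_product, Fintype.mem_piFinset, mem_weightedSimplex hd]
    refine ⟨fun i => Finset.mem_range.2 (Nat.mod_lt _ (hd i)), le_trans ?_ hb⟩
    exact Finset.sum_le_sum fun i _ => by simpa using Nat.div_mul_le_self (b i) (d i)
  · intro b _ b' _ h
    funext i
    rw [Prod.mk.injEq] at h
    rw [← Nat.mod_add_div (b i) (d i), ← Nat.mod_add_div (b' i) (d i), congrFun h.1 i,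
      congrFun h.2 i]

theorem finrank_restrictTotalDegree_le (T : ℕ) :
    Module.finrank F (restrictTotalDegree σ F T) ≤ (weightedSimplex (1 : σ → ℕ) T).card := by
  classical
  have hspan : restrictTotalDegree σ F T = Submodule.span F
      (((weightedSimplex (1 : σ → ℕ) T).image fun a =>
        monomial (Finsupp.equivFunOnFinite.symm a) (1 : F) : Finset _) : Set _) := by
    rw [restrictTotalDegree, restrictSupport_eq_span, Finset.coe_image]
    congr 1
    ext p
    simp only [Set.mem_image, Finset.mem_coe, mem_weightedSimplex (d := (1 : σ → ℕ)) (by simp)]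
    constructor
    · rintro ⟨m, hm, rfl⟩
      exact ⟨m, by simpa [Finsupp.sum_fintype] using hm, by simp⟩
    · rintro ⟨a, ha, rfl⟩
      exact ⟨Finsupp.equivFunOnFinite.symm a, by simpa [Finsupp.sum_fintype] using ha, rfl⟩
  rw [hspan]
  exact (finrank_span_finset_le_card _).trans Finset.card_image_le

theorem exists_card_mul_card_weightedSimplex_le [Infinite F]
    {f : σ → MvPolynomial σ F} {d : σ → ℕ} (hd0 : ∀ i, 0 < d i)
    (hd : ∀ i, (f i).totalDegree ≤ d i)
    {S : Finset (σ → F)} (hS : ∀ s ∈ S, ∀ i, eval s (f i) = 0)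
    (hJ : ∀ s ∈ S, eval s (jacobian f).det ≠ 0) :
    ∃ D : ℕ, ∀ T, S.card * (weightedSimplex d T).card ≤
      (weightedSimplex (1 : σ → ℕ) (T + D)).card := by
  classical
  choose g hg using fun s : S => exists_eval_eq_ite S s.1
  have hg' (s t : S) : eval s.1 (g t) ≠ 0 ↔ s = t := by
    rw [hg t s.1 s.2]
    simp only [ne_eq, ite_eq_right_iff, one_ne_zero, imp_false, not_not, Subtype.ext_iff]
  have hli := linearIndependent_prod_pow_mul (z := ((↑) : S → σ → F)) (fun s => hS s s.2)
    (fun s => hJ s s.2) hg'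
  refine ⟨Finset.univ.sup fun s => (g s).totalDegree, fun T => ?_⟩
  set D := Finset.univ.sup fun s => (g s).totalDegree
  let M := restrictTotalDegree σ F (T + D)
  let p (x : weightedSimplex d T × S) : MvPolynomial σ F := (∏ i, f i ^ x.1.1 i) * g x.2
  have hp (x : weightedSimplex d T × S) : p x ∈ M := by
    rw [mem_restrictTotalDegree]
    refine (totalDegree_mul _ _).trans (add_le_add ?_ ?_)
    · refine (totalDegree_finsetProd _ _).trans
        ((Finset.sum_le_sum fun i _ => ?_).trans ((mem_weightedSimplex hd0).1 x.1.2))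
      exact (totalDegree_pow _ _).trans (Nat.mul_le_mul_left _ (hd i))
    · exact Finset.le_sup (f := fun s => (g s).totalDegree) (Finset.mem_univ x.2)
  let φ (x : weightedSimplex d T × S) : (σ → ℕ) × S := (x.1.1, x.2)
  have hφ : Function.Injective φ := Subtype.val_injective.prodMap Function.injective_id
  have hli' : LinearIndependent F p := hli.comp φ hφ
  calc S.card * (weightedSimplex d T).card = Fintype.card (weightedSimplex d T × S) := by
        rw [Fintype.card_prod, Fintype.card_coe, Fintype.card_coe, mul_comm]
    _ = Module.finrank F (Submodule.span F (Set.range p)) := (finrank_span_eq_card hli').symm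
    _ ≤ Module.finrank F M :=
        Submodule.finrank_mono (Submodule.span_le.2 (Set.range_subset_iff.2 hp))
    _ ≤ (weightedSimplex (1 : σ → ℕ) (T + D)).card := finrank_restrictTotalDegree_le _

end NondegenerateZeros

theorem exists_pow_mul_pow_lt {p : ℕ} (hp : 0 < p) (D N : ℕ) :
    ∃ k, p ^ k * (k * D + 1) ^ N < (p + 1) ^ k := by
  have hp0 : (0 : ℝ) < p := by exact_mod_cast hp
  have hr : 1 < 1 + 1 / (p : ℝ) := by linarith [one_div_pos.2 hp0]
  have hlim := (tendsto_pow_const_div_const_pow_of_one_lt N hr).const_mul (((D : ℝ) + 1) ^ N)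
  rw [mul_zero] at hlim
  obtain ⟨k, hk, hk1⟩ :=
    ((hlim.eventually (gt_mem_nhds one_pos)).and (Filter.eventually_ge_atTop 1)).exists
  refine ⟨k, ?_⟩
  rw [← mul_div_assoc, div_lt_one (by positivity), ← mul_pow,
    show 1 + 1 / (p : ℝ) = (p + 1) / p by field_simp, div_pow, lt_div_iff₀ (by positivity),
    mul_comm] at hk
  have hle : (k * D + 1) ^ N ≤ ((D + 1) * k) ^ N := Nat.pow_le_pow_left (by nlinarith) _
  exact (Nat.mul_le_mul_left _ hle).trans_lt (by exact_mod_cast hk)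

theorem exists_mul_add_lt_mul_of_le_pow {W : ℕ → ℕ} (hW0 : 0 < W 0) {N : ℕ}
    (hW : ∀ T, W T ≤ (T + 1) ^ N) {p : ℕ} (hp : 0 < p) (D : ℕ) :
    ∃ T, p * W (T + D) < (p + 1) * W T := by
  by_contra! hstep
  have hgrow (k : ℕ) : (p + 1) ^ k ≤ p ^ k * W (k * D) := by
    induction k with
    | zero => simpa using Nat.succ_le_of_lt hW0
    | succ k ih =>
      calc (p + 1) ^ (k + 1) ≤ (p + 1) * (p ^ k * W (k * D)) := by
            rw [pow_succ']; exact Nat.mul_le_mul_left _ ih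
        _ = p ^ k * ((p + 1) * W (k * D)) := by ring
        _ ≤ p ^ k * (p * W (k * D + D)) := Nat.mul_le_mul_left _ (hstep _)
        _ = p ^ (k + 1) * W ((k + 1) * D) := by rw [Nat.succ_mul]; ring
  obtain ⟨k, hk⟩ := exists_pow_mul_pow_lt hp D N
  exact hk.not_ge ((hgrow k).trans (Nat.mul_le_mul_left _ (hW _)))

/-- **Bézout's bound** for nondegenerate zeros. Comparing dimensions in degree at most `T`, as
`T → ∞`, of all polynomials and of the span of the products in
`linearIndependent_prod_pow_mul` gives the bound without any intersection theory. -/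
theorem card_nondegenerate_zeros_le {σ F : Type*} [Field F] [Infinite F] [Fintype σ]
    [DecidableEq σ] {f : σ → MvPolynomial σ F} {d : σ → ℕ} (hd0 : ∀ i, 0 < d i)
    (hd : ∀ i, (f i).totalDegree ≤ d i)
    {S : Finset (σ → F)} (hS : ∀ s ∈ S, ∀ i, eval s (f i) = 0)
    (hJ : ∀ s ∈ S, eval s (jacobian f).det ≠ 0) :
    S.card ≤ ∏ i, d i := by
  obtain ⟨D, hD⟩ := exists_card_mul_card_weightedSimplex_le hd0 hd hS hJ
  by_contra! hlt
  have hzero : (0 : σ → ℕ) ∈ weightedSimplex (1 : σ → ℕ) 0 :=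
    (mem_weightedSimplex (by simp)).2 (by simp)
  obtain ⟨T, hT⟩ := exists_mul_add_lt_mul_of_le_pow (Finset.card_pos.2 ⟨_, hzero⟩)
    (card_weightedSimplex_le 1) (Finset.prod_pos fun i _ => hd0 i) D
  refine hT.not_ge ?_
  calc (∏ i, d i + 1) * (weightedSimplex 1 T).card
      ≤ S.card * ((∏ i, d i) * (weightedSimplex d T).card) :=
        Nat.mul_le_mul hlt (card_weightedSimplex_one_le hd0 T)
    _ = (∏ i, d i) * (S.card * (weightedSimplex d T).card) := by ring
    _ ≤ (∏ i, d i) * (weightedSimplex 1 (T + D)).card := Nat.mul_le_mul_left _ (hD T)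

section JacobianCriterion

/-- Differentiate a nonzero relation `p(x) = 0` of least degree. -/
theorem derivation_eq_zero_of_isAlgebraic {A B : Type*} [CommRing A] [IsDomain A] [CharZero A]
    [CommRing B] [IsDomain B] [Algebra A B] [FaithfulSMul A B] (D : Derivation A B B) {x : B}
    (hx : IsAlgebraic A x) : D x = 0 := by
  obtain ⟨p, ⟨hp0, hpx⟩, hmin⟩ := WellFounded.has_min
    (measure (Polynomial.natDegree : Polynomial A → ℕ)).wf
    {p | p ≠ 0 ∧ Polynomial.aeval x p = 0} hx
  have hdeg : p.natDegree ≠ 0 := by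
    intro h
    rw [Polynomial.eq_C_of_natDegree_eq_zero h] at hp0 hpx
    rw [Polynomial.aeval_C, FaithfulSMul.algebraMap_eq_zero_iff] at hpx
    exact hp0 (by rw [hpx, Polynomial.C_0])
  have hder : Polynomial.aeval x p.derivative ≠ 0 := fun h =>
    hmin p.derivative ⟨fun h0 => hdeg (Polynomial.derivative_eq_zero.1 h0), h⟩
      (Polynomial.natDegree_derivative_lt hdeg)
  have hleibniz := D.map_aeval p x
  rw [hpx, map_zero, smul_eq_mul] at hleibniz
  exact (mul_eq_zero.1 hleibniz.symm).resolve_left hder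

theorem mkDerivation_eq_sum_pderiv {σ R : Type*} [CommSemiring R] [Fintype σ]
    (v : σ → MvPolynomial σ R) (p : MvPolynomial σ R) :
    mkDerivation R v p = ∑ j, pderiv j p * v j := by
  classical
  induction p using MvPolynomial.induction_on with
  | C a => simp
  | add p q hp hq => simp [hp, hq, add_mul, Finset.sum_add_distrib]
  | mul_X p i hp =>
    simp only [Derivation.leibniz, hp, mkDerivation_X, smul_eq_mul, pderiv_X, add_mul,
      Finset.sum_add_distrib, Pi.single_apply, Finset.mul_sum]
    simp [mul_assoc]

/-- The **Jacobian criterion**. A vector in the kernel of the Jacobian matrix would define a nonzero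
derivation that vanishes on the `f i`, hence on everything algebraic over them. -/
theorem det_jacobian_ne_zero {σ : Type*} [Fintype σ] [DecidableEq σ] {f : σ → MvPolynomial σ ℤ}
    (hf : AlgebraicIndependent ℤ f) : (jacobian f).det ≠ 0 := by
  intro h0
  obtain ⟨v, hv0, hv⟩ := Matrix.exists_mulVec_eq_zero_iff.2 h0
  let A := Algebra.adjoin ℤ (Set.range f)
  let D₀ : Derivation ℤ (MvPolynomial σ ℤ) (MvPolynomial σ ℤ) := mkDerivation ℤ v
  have hD₀ : Set.EqOn D₀ (0 : Derivation ℤ (MvPolynomial σ ℤ) (MvPolynomial σ ℤ)) A := by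
    refine Derivation.eqOn_adjoin ?_
    rintro _ ⟨i, rfl⟩
    exact (mkDerivation_eq_sum_pderiv v (f i)).trans (congrFun hv i)
  let D : Derivation A (MvPolynomial σ ℤ) (MvPolynomial σ ℤ) :=
    { D₀ with
      map_smul' := fun a x => by
        have ha : D₀ a = 0 := hD₀ a.2
        change D₀ (a * x) = a * D₀ x
        simp [D₀.leibniz, ha] }
  have htr : IsTranscendenceBasis ℤ f :=
    hf.isTranscendenceBasis_of_lift_trdeg_le_of_finite (by simp)
  refine hv0 (funext fun j => ?_)
  have hXj : D₀ (X j) = 0 :=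
    derivation_eq_zero_of_isAlgebraic D (htr.isAlgebraic.isAlgebraic (X j))
  simpa [D₀, mkDerivation_X] using hXj

theorem totalDegree_pos_of_algebraicIndependent {σ ι R : Type*} [CommRing R] [Nontrivial R]
    {f : ι → MvPolynomial σ R} (hf : AlgebraicIndependent R f) (i : ι) :
    0 < (f i).totalDegree := by
  rw [Nat.pos_iff_ne_zero]
  intro h
  refine hf.transcendental i ?_
  rw [totalDegree_eq_zero_iff_eq_C.1 h]
  exact isAlgebraic_algebraMap _

theorem totalDegree_pderiv_le {σ R : Type*} [CommSemiring R] (j : σ) (p : MvPolynomial σ R) :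
    (pderiv j p).totalDegree ≤ p.totalDegree - 1 := by
  classical
  conv_lhs => rw [← support_sum_monomial_coeff p, map_sum]
  refine totalDegree_finsetSum_le fun m hm => ?_
  rw [pderiv_monomial]
  by_cases hmj : m j = 0
  · simp [hmj]
  refine (totalDegree_monomial_le _ _).trans ?_
  have hdeg : m.degree ≤ p.totalDegree := le_totalDegree hm
  have hsub : m.degree = (m - Finsupp.single j 1).degree + 1 := by
    conv_lhs => rw [← Finsupp.sub_add_single_one_cancel hmj]
    simp
  change (m - Finsupp.single j 1).degree ≤ _
  omega

theorem totalDegree_det_jacobian_add_card_le {σ R : Type*} [CommRing R] [Fintype σ] [DecidableEq σ]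
    {f : σ → MvPolynomial σ R} (hf : ∀ i, 0 < (f i).totalDegree) :
    (jacobian f).det.totalDegree + Fintype.card σ ≤ ∑ i, (f i).totalDegree := by
  have hdet : (jacobian f).det.totalDegree ≤ ∑ i, ((f i).totalDegree - 1) := by
    rw [← Matrix.det_transpose, Matrix.det_apply]
    refine totalDegree_finsetSum_le fun s _ => ?_
    rw [Units.smul_def]
    refine (totalDegree_smul_le _ _).trans ((totalDegree_finsetProd _ _).trans ?_)
    exact Finset.sum_le_sum fun i _ => totalDegree_pderiv_le _ _
  calc (jacobian f).det.totalDegree + Fintype.card σ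
      ≤ ∑ i, ((f i).totalDegree - 1) + Fintype.card σ := Nat.add_le_add_right hdet _
    _ = ∑ i, ((f i).totalDegree - 1 + 1) := by simp [Finset.sum_add_distrib]
    _ = ∑ i, (f i).totalDegree := Finset.sum_congr rfl fun i _ => Nat.sub_add_cancel (hf i)

end JacobianCriterion

end InvariantBound

namespace InvariantBound

open Module NumberField MvPolynomial

/-! ### Points of conjugates -/

section Heights

variable {τ : Type*}

theorem eval_one_absPoly (f : MvPolynomial τ ℤ) :
    eval (fun _ => (1 : ℤ)) (absPoly f) = ∑ m ∈ f.support, |f.coeff m| := by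
  simp [absPoly, eval_monomial]

theorem one_le_eval_one_absPoly {f : MvPolynomial τ ℤ} (hf : f ≠ 0) :
    1 ≤ eval (fun _ => (1 : ℤ)) (absPoly f) := by
  rw [eval_one_absPoly]
  obtain ⟨m, hm⟩ := support_nonempty.2 hf
  exact (Int.one_le_abs (mem_support_iff.1 hm)).trans
    (Finset.single_le_sum (f := fun m => |f.coeff m|) (fun _ _ => abs_nonneg _) hm)

theorem norm_aeval_le (f : MvPolynomial τ ℤ) {H : ℝ} (hH : 1 ≤ H) {z : τ → ℂ}
    (hz : ∀ i, ‖z i‖ ≤ H) :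
    ‖aeval z f‖ ≤ (eval (fun _ => (1 : ℤ)) (absPoly f) : ℝ) * H ^ f.totalDegree := by
  rw [eval_one_absPoly, aeval_def, eval₂_eq, Int.cast_sum, Finset.sum_mul]
  refine (norm_sum_le _ _).trans (Finset.sum_le_sum fun m hm => ?_)
  rw [norm_mul, algebraMap_int_eq, eq_intCast, Complex.norm_intCast, norm_prod, Int.cast_abs]
  gcongr
  calc ∏ i ∈ m.support, ‖z i ^ m i‖ ≤ ∏ i ∈ m.support, H ^ m i := by
        refine Finset.prod_le_prod (fun i _ => norm_nonneg _) fun i _ => ?_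
        rw [norm_pow]
        exact pow_le_pow_left₀ (norm_nonneg _) (hz i) _
    _ = H ^ (∑ i ∈ m.support, m i) := Finset.prod_pow_eq_pow_sum _ _ _
    _ ≤ _ := pow_le_pow_right₀ hH (le_totalDegree hm)

theorem houseSpan_finrank_mul_eq_top {k K : Type*} [Field k] [NumberField k] [Field K]
    [NumberField K] [Algebra k K] {l : ℝ} (h : houseSpan K l = ⊤) :
    houseSpan k (finrank k K * l) = ⊤ := by
  have : FiniteDimensional k K := Module.Finite.of_restrictScalars_finite ℚ k K
  let T : K →ₗ[ℚ] k := (Algebra.trace k K).restrictScalars ℚ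
  have hT : LinearMap.range T = ⊤ := LinearMap.range_eq_top.2 (Algebra.trace_surjective k K)
  rw [eq_top_iff, ← hT, LinearMap.range_eq_map, ← h, houseSpan, Submodule.map_span]
  refine Submodule.span_mono ?_
  rintro _ ⟨_, ⟨a, ha, rfl⟩, rfl⟩
  refine ⟨⟨Algebra.trace k K a, Algebra.isIntegral_trace a.isIntegral_coe⟩, ?_, rfl⟩
  change house (Algebra.trace k K (a : K)) ≤ _
  rw [house, canonicalEmbedding.norm_le_iff]
  intro ψ
  let _ : Algebra k ℂ := ψ.toAlgebra
  calc ‖ψ (Algebra.trace k K (a : K))‖ = ‖∑ σ : K →ₐ[k] ℂ, σ (a : K)‖ :=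
        congrArg _ (trace_eq_sum_embeddings ℂ)
    _ ≤ ∑ σ : K →ₐ[k] ℂ, ‖σ (a : K)‖ := norm_sum_le _ _
    _ ≤ ∑ _σ : K →ₐ[k] ℂ, l :=
        Finset.sum_le_sum fun σ _ => (norm_embedding_le_house (a : K) (σ : K →+* ℂ)).trans ha
    _ = finrank k K * l := by simp [AlgHom.card]

end Heights

section AffineSubstitution

theorem totalDegree_aeval_le {σ τ R : Type*} [CommSemiring R] {g : σ → MvPolynomial τ R}
    (hg : ∀ i, (g i).totalDegree ≤ 1) (p : MvPolynomial σ R) :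
    (aeval g p).totalDegree ≤ p.totalDegree := by
  rw [aeval_def, eval₂_eq]
  refine totalDegree_finsetSum_le fun m hm => (totalDegree_mul _ _).trans ?_
  rw [algebraMap_eq, totalDegree_C, zero_add]
  refine (totalDegree_finsetProd _ _).trans (le_trans (Finset.sum_le_sum fun i _ => ?_)
    (le_totalDegree hm))
  exact (totalDegree_pow _ _).trans ((Nat.mul_le_mul_left _ (hg i)).trans (mul_one _).le)

theorem exists_forall_mem_eval_eval_ne_zero {σ τ R : Type*} [CommRing R] [IsDomain R] [Infinite R]
    [Finite τ] {g : σ → MvPolynomial τ R} (hg : ∀ i, (g i).totalDegree ≤ 1)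
    (hsurj : Function.Surjective fun (w : τ → R) i => eval w (g i)) {P : MvPolynomial σ R}
    (hP : P ≠ 0) {I : Finset R} (hI : P.totalDegree < I.card) :
    ∃ w : τ → R, (∀ x, w x ∈ I) ∧ eval (fun i => eval w (g i)) P ≠ 0 := by
  have eval_aeval (w : τ → R) : eval w (aeval g P) = eval (fun i => eval w (g i)) P := by
    rw [aeval_def, eval_eval₂]
    exact congrArg (fun φ => eval₂ φ _ P) (RingHom.ext fun c => eval_C c)
  obtain ⟨v, hv⟩ : ∃ v, eval v P ≠ 0 := by
    by_contra! h
    exact hP (MvPolynomial.funext fun v => by rw [h, map_zero])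
  have hQ : aeval g P ≠ 0 := by
    obtain ⟨w, rfl⟩ := hsurj v
    rw [← eval_aeval] at hv
    exact fun h => hv (by rw [h, map_zero])
  by_contra! h
  refine hQ (eq_zero_of_eval_zero_at_prod_finset _ (fun _ => I) (fun x => ?_)
    fun w hw => (eval_aeval w).trans (h w hw))
  exact ((degreeOf_le_totalDegree _ _).trans (totalDegree_aeval_le hg P)).trans_lt hI

end AffineSubstitution

section ConjugatePoints

variable {ι κ k K N Ω : Type*} [Field k] [Field K] [Field N] [Field Ω] [Algebra k K] [Algebra k N]
  [Algebra k Ω]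

/-- The point of `(𝔸ⁿ)ʳ` whose coordinates are the conjugates of `α₁, …, αᵣ`; the embeddings `τ`
number the conjugates. -/
def conjPoint (τ : ι → (K →ₐ[k] Ω)) (α : κ → K) : κ × ι → Ω :=
  fun x => τ x.2 (α x.1)

theorem span_range_conjugates_eq_top [Finite ι] {μ : Type*} {τ : ι → (K →ₐ[k] Ω)}
    (hτ : Function.Injective τ) {b : μ → K} (hb : Submodule.span k (Set.range b) = ⊤) :
    Submodule.span Ω (Set.range fun l i => τ i (b l)) = ⊤ := by
  classical
  have := Fintype.ofFinite ι
  by_contra hne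
  obtain ⟨φ, hφ0, hφ⟩ := Submodule.exists_le_ker_of_lt_top _ (lt_top_iff_ne_top.2 hne)
  have φ_apply (w : ι → Ω) : φ w = ∑ i, φ (Pi.single i 1) * w i := by
    conv_lhs => rw [← Finset.univ_sum_single w, map_sum]
    exact Finset.sum_congr rfl fun i _ => by
      rw [mul_comm, ← smul_eq_mul, ← map_smul, ← Pi.single_smul, smul_eq_mul, mul_one]
  have φ_conj : φ.restrictScalars k ∘ₗ LinearMap.pi (fun i => (τ i).toLinearMap) = 0 :=
    LinearMap.ext_on_range hb fun l => hφ (Submodule.subset_span ⟨l, rfl⟩)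
  have hli := Fintype.linearIndependent_iff.1 ((linearIndependent_toLinearMap k K Ω).comp τ hτ)
  have φ_single : ∀ i, φ (Pi.single i 1) = 0 := hli _ <| LinearMap.ext fun x => by
    simpa using (φ_apply fun i => τ i x).symm.trans (LinearMap.congr_fun φ_conj x)
  exact hφ0 (LinearMap.ext fun w => by rw [φ_apply]; simp [φ_single])

theorem exists_eval_conjPoint_ne_zero [CharZero Ω] [Finite ι] {μ : Type*} [Finite κ] [Fintype μ]
    {τ : ι → (K →ₐ[k] Ω)} (hτ : Function.Injective τ) {b : μ → K}
    (hb : Submodule.span k (Set.range b) = ⊤) {P : MvPolynomial (κ × ι) Ω} (hP : P ≠ 0)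
    (a : κ → K) {I : Finset ℤ} (hI : P.totalDegree < I.card) :
    ∃ t : κ × μ → I, eval (conjPoint τ fun j => a j + ∑ l, (t (j, l) : ℤ) • b l) P ≠ 0 := by
  let g (x : κ × ι) : MvPolynomial (κ × μ) Ω :=
    C (τ x.2 (a x.1)) + ∑ l, C (τ x.2 (b l)) * X (x.1, l)
  have hg (x) : (g x).totalDegree ≤ 1 := by
    refine (totalDegree_add _ _).trans (max_le (by simp) ?_)
    refine totalDegree_finsetSum_le fun l _ => (totalDegree_mul _ _).trans ?_
    rw [totalDegree_C, totalDegree_X]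
  have eval_g (w : κ × μ → Ω) (x) :
      eval w (g x) = τ x.2 (a x.1) + ∑ l, w (x.1, l) * τ x.2 (b l) := by
    simp [g, mul_comm]
  have hsurj : Function.Surjective fun (w : κ × μ → Ω) x => eval w (g x) := by
    intro v
    have hv (j : κ) : (fun i => v (j, i) - τ i (a j)) ∈
        Submodule.span Ω (Set.range fun l i => τ i (b l)) := by
      rw [span_range_conjugates_eq_top hτ hb]; trivial
    choose c hc using fun j => (Submodule.mem_span_range_iff_exists_fun Ω).1 (hv j)
    refine ⟨fun x => c x.1 x.2, funext fun x => ?_⟩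
    have hx : ∑ l, c x.1 l * τ x.2 (b l) = v x - τ x.2 (a x.1) := by
      simpa using congrFun (hc x.1) x.2
    exact (eval_g _ x).trans (by rw [hx, add_sub_cancel])
  obtain ⟨w, hwI, hw⟩ := exists_forall_mem_eval_eval_ne_zero hg hsurj hP
    (I := I.map ⟨Int.cast, Int.cast_injective⟩) (by rwa [Finset.card_map])
  choose t htI htw using fun x => Finset.mem_map.1 (hwI x)
  have hpt : (conjPoint τ fun j => a j + ∑ l, t (j, l) • b l) = fun x => eval w (g x) := by
    funext x
    simp [eval_g, conjPoint, ← htw]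
  refine ⟨fun x => ⟨t x, htI x⟩, ?_⟩
  rwa [← hpt] at hw

theorem aeval_conjPoint_comp (ψ : N →ₐ[k] Ω) (τ : ι → (K →ₐ[k] N)) (α : κ → K)
    (f : MvPolynomial (κ × ι) ℤ) :
    aeval (conjPoint (fun i => ψ.comp (τ i)) α) f = ψ (aeval (conjPoint τ α) f) :=
  (MvPolynomial.comp_aeval_apply (f := conjPoint τ α) (ψ.restrictScalars ℤ) f).symm

theorem aeval_conjPoint_permute {n r : ℕ} (g : Equiv.Perm (Fin n)) (τ : Fin n → (K →ₐ[k] Ω))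
    (α : Fin r → K) (f : MvPolynomial (Fin r × Fin n) ℤ) :
    aeval (conjPoint τ α) (permute g f) = aeval (conjPoint (fun i => τ (g i)) α) f :=
  aeval_rename _ _ _

theorem aeval_conjPoint_mem_range_algebraMap [IsGalois k N] [FiniteDimensional k N] {n r : ℕ}
    {G : Subgroup (Equiv.Perm (Fin n))} {τ : Fin n → (K →ₐ[k] N)}
    (hτ : ∀ σ : N ≃ₐ[k] N, ∃ g ∈ G, ∀ i, σ.toAlgHom.comp (τ i) = τ (g i))
    {f : MvPolynomial (Fin r × Fin n) ℤ} (hf : IsInvariant G f) (α : Fin r → K) :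
    aeval (conjPoint τ α) f ∈ Set.range (algebraMap k N) := by
  refine (IsGalois.mem_range_algebraMap_iff_fixed _).2 fun σ => ?_
  obtain ⟨g, hg, hσ⟩ := hτ σ
  calc σ (aeval (conjPoint τ α) f) = aeval (conjPoint (fun i => σ.toAlgHom.comp (τ i)) α) f :=
        (aeval_conjPoint_comp σ.toAlgHom τ α f).symm
    _ = aeval (conjPoint τ α) (permute g f) := by
        simp only [hσ, aeval_conjPoint_permute]
    _ = aeval (conjPoint τ α) f := by rw [hf g hg]

theorem isIntegral_of_algebraMap_eq_aeval_conjPoint (τ : ι → (K →ₐ[k] Ω)) (α : κ → 𝓞 K)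
    {f : MvPolynomial (κ × ι) ℤ} {c : k}
    (hc : algebraMap k Ω c = aeval (conjPoint τ fun j => (α j : K)) f) : IsIntegral ℤ c := by
  refine (isIntegral_algHom_iff ((Algebra.ofId k Ω).restrictScalars ℤ)
    (algebraMap k Ω).injective).1 ?_
  change IsIntegral ℤ (algebraMap k Ω c)
  rw [hc, aeval_def, eval₂_eq]
  refine IsIntegral.sum _ fun m _ => isIntegral_algebraMap.mul
    (IsIntegral.prod _ fun x _ => IsIntegral.pow ?_ _)
  exact (α x.1).isIntegral_coe.map ((τ x.2).restrictScalars ℤ)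

theorem house_le_of_algebraMap_eq_aeval_conjPoint [NumberField k] [NumberField K]
    [Algebra.IsAlgebraic k Ω] (τ : ι → (K →ₐ[k] Ω)) {α : κ → K} {H : ℝ} (hH : 1 ≤ H)
    (hα : ∀ j, house (α j) ≤ H) {f : MvPolynomial (κ × ι) ℤ} {c : k}
    (hc : algebraMap k Ω c = aeval (conjPoint τ α) f) :
    house c ≤ (eval (fun _ => (1 : ℤ)) (absPoly f) : ℝ) * H ^ f.totalDegree := by
  rw [house, canonicalEmbedding.norm_le_iff]
  intro ψ
  let _ : Algebra k ℂ := ψ.toAlgebra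
  let Ψ : Ω →ₐ[k] ℂ := IsAlgClosed.lift
  have hψ : ψ c = aeval (conjPoint (fun i => Ψ.comp (τ i)) α) f := by
    rw [aeval_conjPoint_comp, ← hc, Ψ.commutes]
    rfl
  rw [hψ]
  exact norm_aeval_le f hH fun x =>
    (norm_embedding_le_house (α x.1) (Ψ.comp (τ x.2) : K →+* ℂ)).trans (hα x.1)

end ConjugatePoints

section Embeddings

variable {k Ω : Type*} [Field k] [Field Ω] [Algebra k Ω] [IsAlgClosure k Ω] {n r : ℕ}
  {K : IntermediateField k Ω} [FiniteDimensional k K]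

theorem exists_embeddings [PerfectField k] {G : Subgroup (Equiv.Perm (Fin n))}
    (hG : MulAction.IsPretransitive G (Fin n)) (hK : HasGaloisGroup G K) (i₀ : Fin n) :
    ∃ τ : Fin n → (K →ₐ[k] Ω), τ i₀ = K.val ∧ Function.Injective τ ∧
      ∀ f : MvPolynomial (Fin r × Fin n) ℤ, IsInvariant G f → ∀ α : Fin r → K,
        ∃ c : k, algebraMap k Ω c = aeval (conjPoint τ α) f := by
  obtain ⟨e, φ, hφ⟩ := hK
  have : Algebra.IsAlgebraic k Ω := IsAlgClosure.isAlgebraic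
  have : Normal k Ω := IsAlgClosure.normal k Ω
  let N := IntermediateField.normalClosure k K Ω
  let incl : K →ₐ[k] N := IntermediateField.inclusion K.le_normalClosure
  obtain ⟨g, hg⟩ := hG.exists_smul_eq (e incl) i₀
  let σ₀ : N ≃ₐ[k] N := φ.symm g
  have hσ₀ : e.symm i₀ = σ₀.toAlgHom.comp incl := by
    rw [Equiv.symm_apply_eq, hφ, MulEquiv.apply_symm_apply]
    exact hg.symm
  have hτ (σ : N ≃ₐ[k] N) : ∃ g ∈ G, ∀ i, σ.toAlgHom.comp (e.symm i) = e.symm (g i) := by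
    refine ⟨φ σ, (φ σ).2, fun i => ?_⟩
    rw [Equiv.eq_symm_apply, hφ, Equiv.apply_symm_apply]
  let ψ : N →ₐ[k] Ω := N.val.comp σ₀.symm.toAlgHom
  refine ⟨fun i => ψ.comp (e.symm i), ?_, fun i j hij => e.symm.injective ?_, fun f hf α => ?_⟩
  · ext x
    simp only [hσ₀]
    change ((σ₀.symm (σ₀ (incl x)) : N) : Ω) = x
    rw [AlgEquiv.symm_apply_apply]
    rfl
  · exact AlgHom.ext fun x => ψ.injective (DFunLike.congr_fun hij x)
  · obtain ⟨c, hc⟩ := aeval_conjPoint_mem_range_algebraMap hτ hf α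
    exact ⟨c, by rw [aeval_conjPoint_comp, ← hc, ψ.commutes]⟩

theorem adjoin_eq_of_injective [PerfectField k] (hn : finrank k K = n)
    {τ : Fin n → (K →ₐ[k] Ω)} (hτ : Function.Injective τ) {a : K}
    (ha : Function.Injective fun i => τ i a) : IntermediateField.adjoin k {(a : Ω)} = K := by
  have : IsAlgClosed Ω := IsAlgClosure.isAlgClosed k
  have hbij : Function.Bijective τ :=
    (Fintype.bijective_iff_injective_and_card τ).2 ⟨hτ, by simp [AlgHom.card, hn]⟩
  have htop : IntermediateField.adjoin k {a} = ⊤ := by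
    rw [Field.primitive_element_iff_algHom_eq_of_eval' k Ω (fun _ => IsAlgClosed.splits _)]
    intro φ ψ h
    obtain ⟨i, rfl⟩ := hbij.2 φ
    obtain ⟨j, rfl⟩ := hbij.2 ψ
    rw [ha h]
  have := congrArg (IntermediateField.map K.val) htop
  rwa [IntermediateField.adjoin_map, Set.image_singleton, ← AlgHom.fieldRange_eq_map,
    IntermediateField.fieldRange_val] at this

end Embeddings

section BadLocus

variable {n r : ℕ}

/-- The Jacobian determinant times the discriminant factor of the `j₀`-th copy of `𝔸ⁿ`. Away from
its zero set, `f` is étale and the `j₀`-th coordinate of a point of conjugates is a primitive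
element. -/
noncomputable def badLocus (f : Fin r × Fin n → MvPolynomial (Fin r × Fin n) ℤ) (j₀ : Fin r) :
    MvPolynomial (Fin r × Fin n) ℤ :=
  (jacobian f).det * ∏ i : Fin n, ∏ i' ∈ Finset.Ioi i, (X (j₀, i') - X (j₀, i))

theorem badLocus_ne_zero {f : Fin r × Fin n → MvPolynomial (Fin r × Fin n) ℤ}
    (hf : AlgebraicIndependent ℤ f) (j₀ : Fin r) : badLocus f j₀ ≠ 0 := by
  refine mul_ne_zero (det_jacobian_ne_zero hf) (Finset.prod_ne_zero_iff.2 fun i _ =>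
    Finset.prod_ne_zero_iff.2 fun i' hi' => sub_ne_zero.2 fun h => ?_)
  exact (Finset.mem_Ioi.1 hi').ne' (congrArg Prod.snd (X_injective h))

theorem totalDegree_prod_Ioi_sub_le {σ R : Type*} [CommRing R] [Nontrivial R] (s : Fin n → σ) :
    (∏ i : Fin n, ∏ i' ∈ Finset.Ioi i, (X (s i') - X (s i)) : MvPolynomial σ R).totalDegree ≤
      n.choose 2 := by
  calc _ ≤ ∑ i : Fin n, ∑ i' ∈ Finset.Ioi i, 1 := by
        refine (totalDegree_finsetProd _ _).trans (Finset.sum_le_sum fun i _ => ?_)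
        refine (totalDegree_finsetProd _ _).trans (Finset.sum_le_sum fun i' _ => ?_)
        exact (totalDegree_sub _ _).trans (by simp)
    _ = ∑ i : Fin n, (n - 1 - i) := by simp
    _ = n.choose 2 := by
        rw [Fin.sum_univ_eq_sum_range (fun i => n - 1 - i) n, Finset.sum_range_reflect
          (fun i => i) n, Finset.sum_range_id, Nat.choose_two_right]

theorem totalDegree_badLocus_add_le {f : Fin r × Fin n → MvPolynomial (Fin r × Fin n) ℤ}
    (hf : ∀ i, 0 < (f i).totalDegree) (j₀ : Fin r) :
    (badLocus f j₀).totalDegree + n * r ≤ degSum f + n.choose 2 := by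
  calc (badLocus f j₀).totalDegree + n * r
      ≤ (jacobian f).det.totalDegree + n.choose 2 + Fintype.card (Fin r × Fin n) := by
        refine Nat.add_le_add ((totalDegree_mul _ _).trans ?_) (by simp [mul_comm])
        exact Nat.add_le_add_left (totalDegree_prod_Ioi_sub_le fun i => (j₀, i)) _
    _ = (jacobian f).det.totalDegree + Fintype.card (Fin r × Fin n) + n.choose 2 :=
        Nat.add_right_comm _ _ _
    _ ≤ degSum f + n.choose 2 := Nat.add_le_add_right (totalDegree_det_jacobian_add_card_le hf) _

variable {A : Type*} [CommRing A]
  {f : Fin r × Fin n → MvPolynomial (Fin r × Fin n) ℤ} {j₀ : Fin r} {y : Fin r × Fin n → A}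

theorem aeval_det_jacobian_ne_zero_of_badLocus (h : aeval y (badLocus f j₀) ≠ 0) :
    aeval y (jacobian f).det ≠ 0 := by
  rw [badLocus, map_mul] at h
  exact left_ne_zero_of_mul h

theorem injective_of_badLocus [IsDomain A] (h : aeval y (badLocus f j₀) ≠ 0) :
    Function.Injective fun i => y (j₀, i) := by
  rw [badLocus, map_mul] at h
  have hprod := right_ne_zero_of_mul h
  simp only [map_prod, map_sub, aeval_X] at hprod
  refine Function.Injective.of_lt_imp_ne fun i i' hii h => hprod ?_
  exact Finset.prod_eq_zero (Finset.mem_univ i)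
    (Finset.prod_eq_zero (Finset.mem_Ioi.2 hii) (sub_eq_zero.2 h.symm))

end BadLocus

section Perturbation

theorem exists_finset_int_card_eq (Q : ℕ) :
    ∃ I : Finset ℤ, I.card = Q ∧ ∀ t ∈ I, |(t : ℝ)| ≤ Q / 2 := by
  refine ⟨Finset.Ico (-((Q / 2 : ℕ) : ℤ)) (Q - (Q / 2 : ℕ)), by simp, fun t ht => ?_⟩
  rw [Finset.mem_Ico] at ht
  have hlower : -(Q : ℤ) ≤ 2 * t := by omega
  have hupper : 2 * t ≤ Q := by omega
  have hlower' : -(Q : ℝ) ≤ 2 * t := by exact_mod_cast hlower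
  have hupper' : 2 * (t : ℝ) ≤ Q := by exact_mod_cast hupper
  rw [abs_le]
  constructor <;> linarith

variable {K : Type*} [Field K] [NumberField K]

theorem house_add_sum_zsmul_le {μ : Type*} [Fintype μ] {B H T : ℝ} (hT : 0 ≤ T) {a : K}
    (ha : house a ≤ H) {b : μ → K} (hb : ∀ i, house (b i) ≤ B) {t : μ → ℤ}
    (ht : ∀ i, |(t i : ℝ)| ≤ T) :
    house (a + ∑ i, t i • b i) ≤ H + Fintype.card μ * (T * B) := by
  refine (house_add_le _ _).trans (add_le_add ha ((house_sum_le_sum_house _ _).trans ?_))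
  calc ∑ i, house (t i • b i) ≤ ∑ _i : μ, T * B := by
        refine Finset.sum_le_sum fun i _ => ?_
        rw [zsmul_eq_mul]
        refine (house_mul_le _ _).trans ?_
        rw [house_intCast, Int.cast_abs]
        exact mul_le_mul (ht i) (hb i) (house_nonneg _) hT
    _ = _ := by simp

variable {k Ω ι κ : Type*} [Field k] [NumberField k] [Field Ω] [Algebra k K] [Algebra k Ω]
  [CharZero Ω] [Finite ι] [Fintype κ]

/- The nonvanishing of `P` costs only a factor depending on its degree: every integral tuple can be
moved off the zero set of `P` by one of `Q ^ ([K : ℚ] r)` small translations. -/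
theorem exists_perturbation [DecidableEq (κ → 𝓞 K)] {B : ℝ} (hB : houseSpan K B = ⊤)
    {τ : ι → (K →ₐ[k] Ω)} (hτ : Function.Injective τ) {P : MvPolynomial (κ × ι) Ω} (hP : P ≠ 0)
    {Q : ℕ} (hPQ : P.totalDegree < Q) :
    ∃ ψ : (κ → 𝓞 K) → κ → 𝓞 K,
      (∀ a, eval (conjPoint τ fun j => (ψ a j : K)) P ≠ 0) ∧
      (∀ a H, (∀ j, house (a j : K) ≤ H) →
        ∀ j, house (ψ a j : K) ≤ H + finrank ℚ K * (Q / 2 * B)) ∧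
      ∀ A : Finset (κ → 𝓞 K),
        A.card ≤ Q ^ (finrank ℚ K * Fintype.card κ) * (A.image ψ).card := by
  classical
  obtain ⟨b, hb⟩ := exists_basis_mem_of_span_eq_top hB
  choose b' hb' hbb' using hb
  have hspan : Submodule.span k (Set.range fun i => (b' i : K)) = ⊤ := by
    refine Submodule.span_eq_top_of_span_eq_top ℚ k _ ?_
    rw [← b.span_eq]
    exact congrArg _ (congrArg _ (funext hbb'))
  obtain ⟨I, hIQ, hI⟩ := exists_finset_int_card_eq Q
  choose t ht using fun a : κ → 𝓞 K =>
    exists_eval_conjPoint_ne_zero hτ hspan hP (fun j => (a j : K)) (hPQ.trans_eq hIQ.symm)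
  let ψ (a : κ → 𝓞 K) (j : κ) : 𝓞 K := a j + ∑ i, (t a (j, i) : ℤ) • b' i
  have coe_ψ (a : κ → 𝓞 K) (j : κ) :
      (ψ a j : K) = (a j : K) + ∑ i, (t a (j, i) : ℤ) • (b' i : K) := by
    simp [ψ, map_sum]
  refine ⟨ψ, fun a => ?_, fun a H ha j => ?_, fun A => ?_⟩
  · simp only [coe_ψ]
    exact ht a
  · rw [coe_ψ]
    simpa using house_add_sum_zsmul_le (by positivity) (ha j) hb'
      fun i => hI _ (t a (j, i)).2
  · refine Finset.card_le_mul_card_image A _ fun c _ => ?_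
    have hcard : Fintype.card (κ × Fin (finrank ℚ K) → I) =
        Q ^ (finrank ℚ K * Fintype.card κ) := by simp [hIQ, mul_comm]
    rw [← hcard, ← Finset.card_univ]
    refine Finset.card_le_card_of_injOn t (fun _ _ => Finset.mem_coe.2 (Finset.mem_univ _)) ?_
    intro a ha a' ha' htt
    have hψ : ψ a = ψ a' := (Finset.mem_filter.1 ha).2.trans (Finset.mem_filter.1 ha').2.symm
    funext j
    have hj := congrFun hψ j
    simp only [ψ, htt] at hj
    exact add_right_cancel hj

theorem exists_finset_eval_conjPoint_ne_zero {B : ℝ} (hB : houseSpan K B = ⊤) (hB0 : 0 < B)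
    {τ : ι → (K →ₐ[k] Ω)} (hτ : Function.Injective τ) {P : MvPolynomial (κ × ι) Ω} (hP : P ≠ 0)
    {Q : ℕ} (hPQ : P.totalDegree < Q) :
    ∃ S : Finset (κ → 𝓞 K),
      (finrank ℚ K * B / 2) ^ (finrank ℚ K * Fintype.card κ) ≤
        S.card * √((|discr K| : ℤ) : ℝ) ^ Fintype.card κ ∧
      ∀ α ∈ S, eval (conjPoint τ fun j => (α j : K)) P ≠ 0 ∧
        ∀ j, house (α j : K) ≤ finrank ℚ K * Q * B := by
  classical
  obtain ⟨ψ, hψP, hψH, hψA⟩ := exists_perturbation (κ := κ) hB hτ hP hPQ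
  set m := finrank ℚ K
  have hm0 : (0 : ℝ) < m := by exact_mod_cast finrank_pos (R := ℚ) (M := K)
  have hQ0 : (0 : ℝ) < Q := by exact_mod_cast (Nat.zero_le _).trans_lt hPQ
  set H : ℝ := Q * (m * B / 2) with hH
  have hfin := finite_house_le K H
  let A : Finset (κ → 𝓞 K) := Fintype.piFinset fun _ => hfin.toFinset
  refine ⟨A.image ψ, ?_, fun α hα => ?_⟩
  · have hQm : (0 : ℝ) < Q ^ (m * Fintype.card κ) := by positivity
    refine le_of_mul_le_mul_left ?_ hQm
    calc (Q : ℝ) ^ (m * Fintype.card κ) * (m * B / 2) ^ (m * Fintype.card κ)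
        = (H ^ m) ^ Fintype.card κ := by rw [← mul_pow, pow_mul]
      _ ≤ ({a : 𝓞 K | house (a : K) ≤ H}.ncard * √((|discr K| : ℤ) : ℝ)) ^ Fintype.card κ :=
          pow_le_pow_left₀ (by positivity)
            (pow_finrank_le_ncard_mul_sqrt_discr K (by positivity)) _
      _ = (A.card : ℕ) * √((|discr K| : ℤ) : ℝ) ^ Fintype.card κ := by
          simp [A, mul_pow, ← Set.ncard_eq_toFinset_card _ hfin]
      _ ≤ (Q ^ (m * Fintype.card κ) * (A.image ψ).card : ℕ) *
            √((|discr K| : ℤ) : ℝ) ^ Fintype.card κ := by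
          gcongr
          exact hψA A
      _ = _ := by push_cast; ring
  · obtain ⟨a, ha, rfl⟩ := Finset.mem_image.1 hα
    have ha' (j) : house (a j : K) ≤ H := by simpa using Fintype.mem_piFinset.1 ha j
    exact ⟨hψP a, fun j => (hψH a H ha' j).trans_eq (by rw [hH]; ring)⟩

end Perturbation

section Points

/-- The points of `𝔸ᴺ(Ω)` at which `f₁, …, f_N` are étale and take values in `𝓞 k` with
`‖fᵢ(y)‖ ≤ Bᵢ`. -/
def boundedPoints (k : Type*) {ι Ω : Type*} [Field k] [Field Ω] [Algebra k Ω] [NumberField k]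
    [Fintype ι] [DecidableEq ι] (f : ι → MvPolynomial ι ℤ) (B : ι → ℝ) : Set (ι → Ω) :=
  {y | aeval y (jacobian f).det ≠ 0 ∧
    ∀ i, ∃ c : 𝓞 k, algebraMap k Ω (c : k) = aeval y (f i) ∧ house (c : k) ≤ B i}

/-- A bound for the values of `f` at points whose coordinates have all their conjugates bounded by
`H`. -/
noncomputable def valueBound {ι τ : Type*} (f : ι → MvPolynomial τ ℤ) (H : ℝ) (i : ι) : ℝ :=
  (eval (fun _ => (1 : ℤ)) (absPoly (f i)) : ℝ) * H ^ (f i).totalDegree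

theorem prod_valueBound {ι τ : Type*} [Fintype ι] (f : ι → MvPolynomial τ ℤ) (H : ℝ) :
    ∏ i, valueBound f H i = evalOne f * H ^ degSum f := by
  simp only [valueBound, Finset.prod_mul_distrib, Finset.prod_pow_eq_pow_sum, evalOne, degSum,
    Int.cast_prod]

theorem le_valueBound {ι τ : Type*} {f : ι → MvPolynomial τ ℤ} {i : ι}
    (hf : 0 < (f i).totalDegree) {H : ℝ} (hH : 1 ≤ H) : H ≤ valueBound f H i := by
  have hcoeff : (1 : ℝ) ≤ (eval (fun _ => (1 : ℤ)) (absPoly (f i)) : ℤ) := by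
    exact_mod_cast one_le_eval_one_absPoly (f := f i) (by rintro h; simp [h] at hf)
  calc H = 1 * H ^ 1 := by ring
    _ ≤ valueBound f H i := mul_le_mul hcoeff (pow_le_pow_right₀ hH hf) (by positivity)
        (zero_le_one.trans hcoeff)

variable {k Ω : Type*} [Field k] [NumberField k] [Field Ω] [Algebra k Ω]

theorem card_le_prod_totalDegree_mul_prod_ncard {ι : Type*} [Fintype ι] [DecidableEq ι]
    {f : ι → MvPolynomial ι ℤ} (hf : ∀ i, 0 < (f i).totalDegree) {B : ι → ℝ}
    {Z : Finset (ι → Ω)} (hZ : (Z : Set (ι → Ω)) ⊆ boundedPoints k f B) :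
    Z.card ≤ (∏ i, (f i).totalDegree) * ∏ i, {a : 𝓞 k | house (a : k) ≤ B i}.ncard := by
  classical
  have : CharZero Ω := charZero_of_injective_algebraMap (algebraMap k Ω).injective
  have hfin i := finite_house_le k (B i)
  have hvalue (y : ι → Ω) : ∃ c : ι → 𝓞 k, y ∈ Z → ∀ i,
      algebraMap k Ω (c i : k) = aeval y (f i) ∧ house (c i : k) ≤ B i := by
    by_cases hy : y ∈ Z
    · choose c hc using (hZ hy).2
      exact ⟨c, fun _ => hc⟩
    · exact ⟨fun _ => 0, fun h => absurd h hy⟩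
  choose c hc using hvalue
  have hfibre (w : ι → 𝓞 k) : {y ∈ Z | c y = w}.card ≤ ∏ i, (f i).totalDegree := by
    let F (i : ι) : MvPolynomial ι Ω :=
      map (algebraMap ℤ Ω) (f i) - C (algebraMap k Ω (w i : k))
    have hJ (y : ι → Ω) : eval y (jacobian F).det = aeval y (jacobian f).det := by
      rw [RingHom.map_det, AlgHom.map_det]
      congr 1
      ext i j
      simp [F, jacobian, pderiv_map, aeval_def, eval_map]
    refine card_nondegenerate_zeros_le (f := F) hf (fun i => ?_) (fun y hy i => ?_) fun y hy => ?_
    · exact (totalDegree_sub_C_le _ _).trans (Finset.sup_mono (support_map_subset _ _))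
    · obtain ⟨hyZ, rfl⟩ := Finset.mem_filter.1 hy
      rw [map_sub, eval_C, (hc y hyZ i).1, eval_map, aeval_def, sub_self]
    · rw [hJ]
      exact (hZ (Finset.mem_filter.1 hy).1).1
  calc Z.card ≤ (∏ i, (f i).totalDegree) * (Z.image c).card :=
        Finset.card_le_mul_card_image Z _ fun w _ => hfibre w
    _ ≤ (∏ i, (f i).totalDegree) * (Fintype.piFinset fun i => (hfin i).toFinset).card := by
        refine Nat.mul_le_mul_left _ (Finset.card_le_card fun w hw => ?_)
        obtain ⟨y, hy, rfl⟩ := Finset.mem_image.1 hw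
        exact Fintype.mem_piFinset.2 fun i => by simpa using (hc y hy i).2
    _ = _ := by
        rw [Fintype.card_piFinset]
        congr! with i
        exact (Set.ncard_eq_toFinset_card _ (hfin i)).symm

theorem prod_ncard_house_le_valueBound_mul_le {ι τ : Type*} [Fintype ι]
    {f : ι → MvPolynomial τ ℤ} (hf : ∀ i, 0 < (f i).totalDegree) {B H : ℝ}
    (hB : houseSpan k B = ⊤) (hH : 1 ≤ H) (hBH : finrank ℚ k * B ≤ H) :
    ((∏ i, {a : 𝓞 k | house (a : k) ≤ valueBound f H i}.ncard : ℕ) : ℝ) *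
        √((|discr k| : ℤ) : ℝ) ^ Fintype.card ι ≤
      (2 * Real.pi) ^ (finrank ℚ k * Fintype.card ι) *
        (evalOne f * H ^ degSum f) ^ finrank ℚ k := by
  have hbox (i) : {a : 𝓞 k | house (a : k) ≤ valueBound f H i}.ncard * √((|discr k| : ℤ) : ℝ) ≤
      (2 * Real.pi) ^ finrank ℚ k * valueBound f H i ^ finrank ℚ k := by
    have hHi := le_valueBound (hf i) hH
    exact ncard_mul_sqrt_discr_le k hB (by linarith) (hBH.trans hHi)
  calc _ = ∏ i, ({a : 𝓞 k | house (a : k) ≤ valueBound f H i}.ncard *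
          √((|discr k| : ℤ) : ℝ)) := by simp [Finset.prod_mul_distrib]
    _ ≤ ∏ i, ((2 * Real.pi) ^ finrank ℚ k * valueBound f H i ^ finrank ℚ k) :=
        Finset.prod_le_prod (fun i _ => by positivity) fun i _ => hbox i
    _ = _ := by
        rw [Finset.prod_mul_distrib, Finset.prod_const, Finset.card_univ, ← pow_mul,
          Finset.prod_pow, prod_valueBound]

end Points

/-! ### Counting fields -/

section Bounds

variable {ι τ : Type*} [Fintype ι] {f : ι → MvPolynomial τ ℤ}

theorem degSum_pos [Nonempty ι] (hf : ∀ i, 0 < (f i).totalDegree) : 0 < degSum f :=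
  Finset.sum_pos (fun i _ => hf i) Finset.univ_nonempty

theorem evalOne_pos (hf : ∀ i, f i ≠ 0) : 0 < evalOne f :=
  Finset.prod_pos fun i _ => zero_lt_one.trans_le (one_le_eval_one_absPoly (hf i))

theorem degSum_comp_equiv {ι' : Type*} [Fintype ι'] (e : ι' ≃ ι) (f : ι → MvPolynomial τ ℤ) :
    degSum (f ∘ e) = degSum f :=
  Equiv.sum_comp e fun i => (f i).totalDegree

theorem evalOne_comp_equiv {ι' : Type*} [Fintype ι'] (e : ι' ≃ ι) (f : ι → MvPolynomial τ ℤ) :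
    evalOne (f ∘ e) = evalOne f :=
  Equiv.prod_comp e fun i => eval (fun _ => (1 : ℤ)) (absPoly (f i))

/-- A bound for the conjugates of the coordinates of the points of `boundedPoints` attached to the
extensions `K/k` of degree `n` with `[k : ℚ] = d` and `λ_max(K) ≤ l`. -/
noncomputable def coordBound (n d : ℕ) (f : ι → MvPolynomial τ ℤ) (l : ℝ) : ℝ :=
  (d * n : ℕ) * (degSum f + n.choose 2 : ℕ) * l

theorem mul_le_coordBound (n d : ℕ) (hf : 0 < degSum f) {l : ℝ} (hl : 0 ≤ l) :
    d * (n * l) ≤ coordBound n d f l := by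
  have hQ : (1 : ℝ) ≤ (degSum f + n.choose 2 : ℕ) := by exact_mod_cast Nat.add_pos_left hf _
  calc d * (n * l) = (d * n : ℕ) * 1 * l := by push_cast; ring
    _ ≤ coordBound n d f l := by
        unfold coordBound
        gcongr

theorem one_le_coordBound {n d : ℕ} (hn : 1 ≤ n) (hd : 1 ≤ d) (hf : 0 < degSum f) {l : ℝ}
    (hl : 1 ≤ l) : 1 ≤ coordBound n d f l := by
  have hn' : (1 : ℝ) ≤ n := by exact_mod_cast hn
  have hd' : (1 : ℝ) ≤ d := by exact_mod_cast hd
  exact (one_le_mul_of_one_le_of_one_le hd' (one_le_mul_of_one_le_of_one_le hn' hl)).trans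
    (mul_le_coordBound n d hf (by linarith))

end Bounds

section Points

variable {k Ω : Type*} [Field k] [NumberField k] [Field Ω] [Algebra k Ω] [IsAlgClosure k Ω]
  {n r : ℕ} {f : Fin r × Fin n → MvPolynomial (Fin r × Fin n) ℤ} {G : Subgroup (Equiv.Perm (Fin n))}

theorem mem_boundedPoints_of_badLocus {K : IntermediateField k Ω} [NumberField K]
    {τ : Fin n → (K →ₐ[k] Ω)}
    (hτf : ∀ i, ∀ α : Fin r → K, ∃ c : k, algebraMap k Ω c = aeval (conjPoint τ α) (f i))
    {α : Fin r → 𝓞 K} {j₀ : Fin r}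
    (hbad : aeval (conjPoint τ fun j => (α j : K)) (badLocus f j₀) ≠ 0) {H : ℝ} (hH : 1 ≤ H)
    (hα : ∀ j, house (α j : K) ≤ H) :
    conjPoint τ (fun j => (α j : K)) ∈ boundedPoints k f (valueBound f H) := by
  have : Algebra.IsAlgebraic k Ω := IsAlgClosure.isAlgebraic
  refine ⟨aeval_det_jacobian_ne_zero_of_badLocus hbad, fun i => ?_⟩
  obtain ⟨c, hc⟩ := hτf i fun j => (α j : K)
  exact ⟨⟨c, isIntegral_of_algebraMap_eq_aeval_conjPoint τ α hc⟩, hc,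
    house_le_of_algebraMap_eq_aeval_conjPoint τ hH hα hc⟩

theorem exists_finset_boundedPoints {K : IntermediateField k Ω} [NumberField K]
    (hn : finrank k K = n) (hf : AlgebraicIndependent ℤ f)
    (hG : MulAction.IsPretransitive G (Fin n)) (hinv : ∀ i, IsInvariant G (f i))
    (hK : HasGaloisGroup G K) {l : ℝ} (hl : 1 ≤ l) (hKl : lambdaMax K ≤ l) (j₀ : Fin r)
    (i₀ : Fin n) :
    ∃ Y : Finset (Fin r × Fin n → Ω),
      (finrank ℚ K * l / 2) ^ (finrank ℚ K * r) ≤ Y.card * √((|discr K| : ℤ) : ℝ) ^ r ∧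
      (∀ y ∈ Y, IntermediateField.adjoin k {y (j₀, i₀)} = K) ∧
      (Y : Set (Fin r × Fin n → Ω)) ⊆
        boundedPoints k f (valueBound f (coordBound n (finrank ℚ k) f l)) := by
  classical
  have : CharZero Ω := charZero_of_injective_algebraMap (algebraMap k Ω).injective
  have : FiniteDimensional k K := Module.Finite.of_restrictScalars_finite ℚ k K
  obtain ⟨τ, hτ₀, hτ, hτf⟩ := exists_embeddings (r := r) hG hK i₀
  let pt (α : Fin r → 𝓞 K) := conjPoint τ fun j => (α j : K)
  have pt_i₀ (α j) : pt α (j, i₀) = ((α j : K) : Ω) := by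
    simp only [pt, conjPoint, hτ₀]
    rfl
  have hpt : Function.Injective pt := fun α α' h => funext fun j => by
    have hj := congrFun h (j, i₀)
    rw [pt_i₀, pt_i₀] at hj
    exact RingOfIntegers.coe_injective (K.val.injective hj)
  have hdeg := totalDegree_pos_of_algebraicIndependent hf
  have : Nonempty (Fin r × Fin n) := ⟨(j₀, i₀)⟩
  set Q := degSum f + n.choose 2
  have hQdeg : (badLocus f j₀).totalDegree < Q := by
    have hadd := totalDegree_badLocus_add_le hdeg j₀
    have hpos := Nat.mul_pos (Fin.pos i₀) (Fin.pos j₀)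
    lia
  have hP : map (algebraMap ℤ Ω) (badLocus f j₀) ≠ 0 :=
    (map_ne_zero_iff _ (map_injective _ (RingHom.injective_int _))).2 (badLocus_ne_zero hf j₀)
  obtain ⟨S, hS, hSP⟩ := exists_finset_eval_conjPoint_ne_zero
    (houseSpan_eq_top_of_lambdaMax_le hKl) (by linarith) hτ hP
    ((Finset.sup_mono (support_map_subset _ _)).trans_lt hQdeg)
  have hbad {α} (hα : α ∈ S) : aeval (pt α) (badLocus f j₀) ≠ 0 := by
    rw [aeval_def, ← eval_map]
    exact (hSP α hα).1
  have hH : (finrank ℚ K * Q * l : ℝ) = coordBound n (finrank ℚ k) f l := by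
    rw [coordBound, ← finrank_mul_finrank ℚ k K, hn]
  have hH1 := one_le_coordBound (Fin.pos i₀) (finrank_pos (R := ℚ) (M := k)) (degSum_pos hdeg) hl
  refine ⟨S.image pt, ?_, fun y hy => ?_, fun y hy => ?_⟩
  · simpa only [Finset.card_image_of_injective _ hpt, Fintype.card_fin] using hS
  · obtain ⟨α, hα, rfl⟩ := Finset.mem_image.1 hy
    rw [pt_i₀]
    exact adjoin_eq_of_injective hn hτ (injective_of_badLocus (hbad hα))
  · obtain ⟨α, hα, rfl⟩ := Finset.mem_image.1 hy
    exact mem_boundedPoints_of_badLocus (fun i => hτf (f i) (hinv i)) (hbad hα) hH1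
      fun j => hH ▸ (hSP α hα).2 j

end Points

section PointCount

variable {k Ω : Type*} [Field k] [NumberField k] [Field Ω] [Algebra k Ω]
  {n r : ℕ} {G : Subgroup (Equiv.Perm (Fin n))} {X l : ℝ}

theorem prod_mul_two_pow_card_le {ι : Type*} [Fintype ι] {m : ι → ℕ} (hm : ∀ i, 0 < m i) :
    (∏ i, m i) * 2 ^ Fintype.card ι ≤ 2 ^ ∑ i, m i := by
  rw [← Finset.prod_pow_eq_pow_sum, ← Finset.card_univ, ← Finset.prod_const,
    ← Finset.prod_mul_distrib]
  refine Finset.prod_le_prod' fun i _ => ?_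
  calc m i * 2 = (m i - 1 + 1) * 2 := by rw [Nat.sub_add_cancel (hm i)]
    _ ≤ 2 ^ (m i - 1) * 2 := Nat.mul_le_mul_right _ Nat.lt_two_pow_self
    _ = 2 ^ m i := by rw [← pow_succ, Nat.sub_add_cancel (hm i)]

theorem prod_totalDegree_mul_two_pow_le {τ ι : Type*} [Fintype ι] {f : ι → MvPolynomial τ ℤ}
    (hf : ∀ i, 0 < (f i).totalDegree) {d : ℕ} (hd : d ≠ 0) :
    (∏ i, (f i).totalDegree) * 2 ^ (d * Fintype.card ι) ≤ 2 ^ (d * degSum f) := by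
  calc (∏ i, (f i).totalDegree) * 2 ^ (d * Fintype.card ι)
      ≤ (∏ i, (f i).totalDegree) ^ d * 2 ^ (d * Fintype.card ι) :=
        Nat.mul_le_mul_right _ (Nat.le_self_pow hd _)
    _ = ((∏ i, (f i).totalDegree) * 2 ^ Fintype.card ι) ^ d := by
        rw [mul_pow, ← pow_mul, mul_comm d]
    _ ≤ (2 ^ degSum f) ^ d := Nat.pow_le_pow_left (prod_mul_two_pow_card_le hf) d
    _ = 2 ^ (d * degSum f) := by rw [← pow_mul, mul_comm d]

theorem card_mul_le_of_subset_boundedPoints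
    {f : Fin r × Fin n → MvPolynomial (Fin r × Fin n) ℤ} (hf : ∀ i, 0 < (f i).totalDegree)
    {B H : ℝ} (hB : houseSpan k B = ⊤) (hH : 1 ≤ H) (hBH : finrank ℚ k * B ≤ H)
    {Z : Finset (Fin r × Fin n → Ω)}
    (hZ : (Z : Set (Fin r × Fin n → Ω)) ⊆ boundedPoints k f (valueBound f H)) :
    Z.card * (2 ^ (finrank ℚ k * (n * r)) * √((|discr k| : ℤ) : ℝ) ^ (n * r)) ≤
      (2 * Real.pi) ^ (finrank ℚ k * (n * r)) * (evalOne f : ℝ) ^ finrank ℚ k *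
        (2 * H) ^ (finrank ℚ k * degSum f) := by
  set d := finrank ℚ k
  set s := √((|discr k| : ℤ) : ℝ)
  have hN : Fintype.card (Fin r × Fin n) = n * r := by simp [mul_comm]
  have hpoints := card_le_prod_totalDegree_mul_prod_ncard hf hZ
  have hvalues := prod_ncard_house_le_valueBound_mul_le hf hB hH hBH
  have hdeg := prod_totalDegree_mul_two_pow_le hf (finrank_pos (R := ℚ) (M := k)).ne'
  rw [hN] at hvalues hdeg
  set p := ∏ i, (f i).totalDegree
  set v := ∏ i, {a : 𝓞 k | house (a : k) ≤ valueBound f H i}.ncard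
  calc (Z.card : ℝ) * (2 ^ (d * (n * r)) * s ^ (n * r))
      ≤ (p * v : ℕ) * (2 ^ (d * (n * r)) * s ^ (n * r)) := by gcongr
    _ = (p * 2 ^ (d * (n * r)) : ℕ) * (v * s ^ (n * r)) := by push_cast; ring
    _ ≤ (2 ^ (d * degSum f) : ℕ) *
          ((2 * Real.pi) ^ (d * (n * r)) * (evalOne f * H ^ degSum f) ^ d) := by gcongr
    _ = _ := by push_cast; ring

variable [IsAlgClosure k Ω]

/- A point of `boundedPoints` determines the field it comes from: its `(j₀, i₀)` coordinate is a
primitive element. -/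
theorem exists_finset_boundedPoints_of_extensions
    {f : Fin r × Fin n → MvPolynomial (Fin r × Fin n) ℤ} (hn : 1 ≤ n) (hr : 1 ≤ r)
    (hf : AlgebraicIndependent ℤ f) (hG : MulAction.IsPretransitive G (Fin n))
    (hinv : ∀ i, IsInvariant G (f i)) (hl : 1 ≤ l) {S : Finset (IntermediateField k Ω)}
    (hS : (S : Set (IntermediateField k Ω)) ⊆ extensionsMinimaLE k Ω G X l) :
    ∃ Z : Finset (Fin r × Fin n → Ω),
      S.card * (l / 2) ^ (finrank ℚ k * (n * r)) ≤ Z.card * √X ^ r ∧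
      (Z : Set (Fin r × Fin n → Ω)) ⊆
        boundedPoints k f (valueBound f (coordBound n (finrank ℚ k) f l)) := by
  classical
  let j₀ : Fin r := ⟨0, hr⟩
  let i₀ : Fin n := ⟨0, hn⟩
  have hpoints (K : IntermediateField k Ω) : ∃ Y : Finset (Fin r × Fin n → Ω), K ∈ S →
      (l / 2) ^ (finrank ℚ k * (n * r)) ≤ Y.card * √X ^ r ∧
      (∀ y ∈ Y, IntermediateField.adjoin k {y (j₀, i₀)} = K) ∧
      (Y : Set (Fin r × Fin n → Ω)) ⊆
        boundedPoints k f (valueBound f (coordBound n (finrank ℚ k) f l)) := by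
    by_cases hK : K ∈ S
    · obtain ⟨⟨hfr, hgal, _, hdisc⟩, _, hlam⟩ := hS hK
      obtain ⟨Y, hcard, hY⟩ := exists_finset_boundedPoints hfr hf hG hinv hgal hl hlam j₀ i₀
      refine ⟨Y, fun _ => ⟨?_, hY⟩⟩
      have hm : (1 : ℝ) ≤ finrank ℚ K := by exact_mod_cast finrank_pos (R := ℚ) (M := K)
      calc (l / 2) ^ (finrank ℚ k * (n * r)) = (l / 2) ^ (finrank ℚ K * r) := by
            rw [← mul_assoc, ← hfr, finrank_mul_finrank]
        _ ≤ (finrank ℚ K * l / 2) ^ (finrank ℚ K * r) := by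
            gcongr
            exact le_mul_of_one_le_left (by linarith) hm
        _ ≤ Y.card * √((|discr K| : ℤ) : ℝ) ^ r := hcard
        _ ≤ Y.card * √X ^ r := by gcongr
    · exact ⟨∅, fun h => absurd h hK⟩
  choose Y hY using hpoints
  have hdisj : (S : Set (IntermediateField k Ω)).PairwiseDisjoint Y := by
    intro K hK K' hK' hne
    refine Finset.disjoint_left.2 fun y hy hy' => hne ?_
    rw [← (hY K hK).2.1 y hy, ← (hY K' hK').2.1 y hy']
  refine ⟨S.biUnion Y, ?_, fun y hy => ?_⟩
  · rw [Finset.card_biUnion hdisj, Nat.cast_sum, Finset.sum_mul, ← nsmul_eq_mul]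
    exact Finset.card_nsmul_le_sum _ _ _ fun K hK => (hY K hK).1
  · obtain ⟨K, hK, hyK⟩ := Finset.mem_biUnion.1 hy
    exact (hY K hK).2.2 hyK

theorem card_extensions_mul_le {f : Fin r × Fin n → MvPolynomial (Fin r × Fin n) ℤ} (hn : 1 ≤ n)
    (hr : 1 ≤ r) (hf : AlgebraicIndependent ℤ f) (hG : MulAction.IsPretransitive G (Fin n))
    (hinv : ∀ i, IsInvariant G (f i)) (hl : 1 ≤ l) {S : Finset (IntermediateField k Ω)}
    (hS : (S : Set (IntermediateField k Ω)) ⊆ extensionsMinimaLE k Ω G X l) :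
    S.card * (l ^ (finrank ℚ k * (n * r)) * √((|discr k| : ℤ) : ℝ) ^ (n * r)) ≤
      (2 * Real.pi) ^ (finrank ℚ k * (n * r)) * (evalOne f : ℝ) ^ finrank ℚ k *
        (2 * coordBound n (finrank ℚ k) f l) ^ (finrank ℚ k * degSum f) * √X ^ r := by
  obtain ⟨Z, hcard, hZ⟩ := exists_finset_boundedPoints_of_extensions hn hr hf hG hinv hl hS
  have hdeg := totalDegree_pos_of_algebraicIndependent hf
  have : Nonempty (Fin r × Fin n) := ⟨(⟨0, hr⟩, ⟨0, hn⟩)⟩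
  have hH := one_le_coordBound hn (finrank_pos (R := ℚ) (M := k)) (degSum_pos hdeg) hl
  have hI : (0 : ℝ) < evalOne f := by exact_mod_cast evalOne_pos hf.ne_zero
  rcases S.eq_empty_or_nonempty with rfl | ⟨K, hKS⟩
  · rw [Finset.card_empty, Nat.cast_zero, zero_mul]
    positivity
  obtain ⟨⟨hfr, -⟩, _, hlam⟩ := hS hKS
  have hspan : houseSpan k (n * l) = ⊤ :=
    hfr ▸ houseSpan_finrank_mul_eq_top (houseSpan_eq_top_of_lambdaMax_le hlam)
  have hbounded := card_mul_le_of_subset_boundedPoints hdeg hspan hH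
    (mul_le_coordBound n _ (degSum_pos hdeg) (by linarith)) hZ
  set d := finrank ℚ k
  set s := √((|discr k| : ℤ) : ℝ)
  calc S.card * (l ^ (d * (n * r)) * s ^ (n * r))
      = S.card * (l / 2) ^ (d * (n * r)) * (2 ^ (d * (n * r)) * s ^ (n * r)) := by
        rw [div_pow]
        field_simp
    _ ≤ Z.card * √X ^ r * (2 ^ (d * (n * r)) * s ^ (n * r)) := by gcongr
    _ = Z.card * (2 ^ (d * (n * r)) * s ^ (n * r)) * √X ^ r := by ring
    _ ≤ _ := by gcongr

end PointCount

section FieldCount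

variable {k Ω : Type*} [Field k] [NumberField k] [Field Ω] [Algebra k Ω]
  {n r : ℕ} {f : Fin (n * r) → MvPolynomial (Fin r × Fin n) ℤ} {G : Subgroup (Equiv.Perm (Fin n))}
  {X l : ℝ}

theorem explicitConst_pos (hn : 1 ≤ n) (hr : 1 ≤ r) (hf : ∀ i, 0 < (f i).totalDegree) {d : ℕ}
    (hd : 0 < d) : 0 < explicitConst n r d f := by
  have hI : (0 : ℝ) < evalOne f := by
    exact_mod_cast evalOne_pos fun i h => by simpa [h] using hf i
  have : Nonempty (Fin (n * r)) := ⟨⟨0, Nat.mul_pos hn hr⟩⟩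
  have hD : (0 : ℝ) < degSum f := by exact_mod_cast degSum_pos hf
  unfold explicitConst
  positivity

theorem le_explicitConst_mul_pow (hf : ∀ i, f i ≠ 0) (d : ℕ) (hl : 0 ≤ l) :
    (2 * Real.pi) ^ (d * (n * r)) * (evalOne f : ℝ) ^ d *
        (2 * coordBound n d f l) ^ (d * degSum f) ≤
      explicitConst n r d f * l ^ (d * degSum f) := by
  have hI : (0 : ℝ) < evalOne f := by exact_mod_cast evalOne_pos hf
  have hfac : (1 : ℝ) ≤ d.factorial := by exact_mod_cast d.factorial_pos
  have hH : 2 * coordBound n d f l = 2 * d * n * (degSum f + n.choose 2) * l := by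
    rw [coordBound]
    push_cast
    ring
  calc _ ≤ (d.factorial : ℝ) ^ (n * r) * ((2 * Real.pi) ^ (d * (n * r)) * (evalOne f : ℝ) ^ d *
        (2 * coordBound n d f l) ^ (d * degSum f)) := by
        refine le_mul_of_one_le_left ?_ (one_le_pow₀ hfac)
        rw [hH]
        positivity
    _ = _ := by
        rw [hH, mul_pow _ l, explicitConst, mul_assoc d n r]
        ring

theorem extensions_subset_extensionsMinimaLE (hn : 1 ≤ n) :
    extensions k Ω G X ⊆ extensionsMinimaLE k Ω G X (X ^ ((finrank ℚ k * n : ℝ)⁻¹)) := by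
  rintro K ⟨hfr, hgal, hnf, hdisc⟩
  refine ⟨⟨hfr, hgal, hnf, hdisc⟩, hnf, ?_⟩
  have hfrQ : (finrank ℚ k * n : ℝ) = (finrank ℚ K : ℕ) := by
    have : FiniteDimensional k K := FiniteDimensional.of_finrank_pos (by lia)
    rw [← finrank_mul_finrank ℚ k K, hfr, Nat.cast_mul]
  rw [hfrQ]
  calc lambdaMax K = (lambdaMax K ^ finrank ℚ K) ^ ((finrank ℚ K : ℝ)⁻¹) :=
        (Real.pow_rpow_inv_natCast (successiveMinimum_nonneg _) finrank_pos.ne').symm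
    _ ≤ X ^ ((finrank ℚ K : ℝ)⁻¹) :=
        Real.rpow_le_rpow (pow_nonneg (successiveMinimum_nonneg _) _)
          ((lambdaMax_pow_le_discr K).trans hdisc) (by positivity)

variable [IsAlgClosure k Ω]

theorem card_extensions_le (hn : 1 ≤ n) (hr : 1 ≤ r) (hf : AlgebraicIndependent ℤ f)
    (hG : MulAction.IsPretransitive G (Fin n)) (hinv : ∀ i, IsInvariant G (f i)) (hX : 0 ≤ X)
    (hl : 1 ≤ l) {S : Finset (IntermediateField k Ω)}
    (hS : (S : Set (IntermediateField k Ω)) ⊆ extensionsMinimaLE k Ω G X l) :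
    (S.card : ℝ) ≤ explicitConst n r (finrank ℚ k) f *
      (l ^ (finrank ℚ k * (degSum f : ℝ) - finrank ℚ k * n * r) * X ^ ((r : ℝ) / 2) /
        ((|discr k| : ℤ) : ℝ) ^ ((n : ℝ) * r / 2)) := by
  let e : Fin r × Fin n ≃ Fin (n * r) := Fintype.equivOfCardEq (by simp [mul_comm])
  have hcard := card_extensions_mul_le hn hr (hf.comp e e.injective) hG (fun i => hinv (e i)) hl hS
  rw [coordBound, degSum_comp_equiv, evalOne_comp_equiv, ← coordBound] at hcard
  have hconst := le_explicitConst_mul_pow hf.ne_zero (finrank ℚ k) (l := l) (by linarith)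
  set d := finrank ℚ k
  have hl_pow : l ^ (d * (degSum f : ℝ) - d * n * r) = l ^ (d * degSum f) / l ^ (d * (n * r)) := by
    rw [Real.rpow_sub (by linarith), ← Real.rpow_natCast, ← Real.rpow_natCast]
    push_cast
    rw [mul_assoc (d : ℝ)]
  have hX_pow : X ^ ((r : ℝ) / 2) = √X ^ r := by
    rw [Real.rpow_div_two_eq_sqrt _ hX, Real.rpow_natCast]
  have hdiscr_pow : ((|discr k| : ℤ) : ℝ) ^ ((n : ℝ) * r / 2) =
      √((|discr k| : ℤ) : ℝ) ^ (n * r) := by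
    rw [Real.rpow_div_two_eq_sqrt _ (by positivity), ← Nat.cast_mul, Real.rpow_natCast]
  have hs : 0 < √((|discr k| : ℤ) : ℝ) :=
    Real.sqrt_pos.2 (by exact_mod_cast abs_pos.2 (discr_ne_zero k))
  calc (S.card : ℝ) ≤ explicitConst n r d f * l ^ (d * degSum f) * √X ^ r /
        (l ^ (d * (n * r)) * √((|discr k| : ℤ) : ℝ) ^ (n * r)) := by
        rw [le_div_iff₀ (by positivity)]
        exact hcard.trans (by gcongr)
    _ = _ := by
        rw [hl_pow, hX_pow, hdiscr_pow]
        field_simp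

theorem finite_and_ncard_le_of_forall_finset {α : Type*} {s : Set α} {C : ℝ}
    (h : ∀ S : Finset α, (S : Set α) ⊆ s → (S.card : ℝ) ≤ C) :
    s.Finite ∧ (s.ncard : ℝ) ≤ C := by
  have hfin : s.Finite := by
    by_contra hinf
    obtain ⟨S, hS, hcard⟩ := Set.Infinite.exists_subset_card_eq hinf (⌊C⌋₊ + 1)
    have hle := h S hS
    rw [hcard, Nat.cast_succ] at hle
    exact (Nat.lt_floor_add_one C).not_ge hle
  refine ⟨hfin, ?_⟩
  rw [Set.ncard_eq_toFinset_card s hfin]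
  exact h _ hfin.coe_toFinset.subset

theorem extensionsMinimaLE_finite_and_ncard_le (hn : 1 ≤ n) (hr : 1 ≤ r)
    (hf : AlgebraicIndependent ℤ f) (hG : MulAction.IsPretransitive G (Fin n))
    (hinv : ∀ i, IsInvariant G (f i)) (hX : 0 ≤ X) (hl : 1 ≤ l) :
    (extensionsMinimaLE k Ω G X l).Finite ∧ ((extensionsMinimaLE k Ω G X l).ncard : ℝ) ≤
      explicitConst n r (finrank ℚ k) f *
        (l ^ (finrank ℚ k * (degSum f : ℝ) - finrank ℚ k * n * r) * X ^ ((r : ℝ) / 2) /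
          ((|discr k| : ℤ) : ℝ) ^ ((n : ℝ) * r / 2)) :=
  finite_and_ncard_le_of_forall_finset fun _ hS => card_extensions_le hn hr hf hG hinv hX hl hS

theorem extensions_finite_and_ncard_le (hn : 1 ≤ n) (hr : 1 ≤ r) (hf : AlgebraicIndependent ℤ f)
    (hG : MulAction.IsPretransitive G (Fin n)) (hinv : ∀ i, IsInvariant G (f i)) (hX : 1 ≤ X) :
    (extensions k Ω G X).Finite ∧ ((extensions k Ω G X).ncard : ℝ) ≤
      explicitConst n r (finrank ℚ k) f * (X ^ ((degSum f : ℝ) / n - (r : ℝ) / 2) /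
        ((|discr k| : ℤ) : ℝ) ^ ((r : ℝ) * n / 2)) := by
  have hX0 : 0 < X := by linarith
  have hsub := extensions_subset_extensionsMinimaLE (k := k) (Ω := Ω) (G := G) (X := X) hn
  obtain ⟨hfin, hcard⟩ := extensionsMinimaLE_finite_and_ncard_le (k := k) (Ω := Ω) hn hr hf hG
    hinv hX0.le (Real.one_le_rpow hX (by positivity : (0 : ℝ) ≤ (finrank ℚ k * n : ℝ)⁻¹))
  refine ⟨hfin.subset hsub, ?_⟩
  have hd : (finrank ℚ k : ℝ) ≠ 0 := by exact_mod_cast finrank_pos.ne'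
  have hn' : (n : ℝ) ≠ 0 := by exact_mod_cast (show n ≠ 0 by lia)
  calc ((extensions k Ω G X).ncard : ℝ)
      ≤ (extensionsMinimaLE k Ω G X (X ^ ((finrank ℚ k * n : ℝ)⁻¹))).ncard := by
        exact_mod_cast Set.ncard_le_ncard hsub hfin
    _ ≤ _ := hcard
    _ = _ := by
        rw [← Real.rpow_mul hX0.le, ← Real.rpow_add hX0, mul_comm (r : ℝ) n]
        congr 3
        field_simp
        ring

end FieldCount

end InvariantBound

theorem theorem3p1 (n r : ℕ) (hn : 1 ≤ n) (hr : 1 ≤ r)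
    (f : Fin (n * r) → MvPolynomial (Fin r × Fin n) ℤ) (hf : AlgebraicIndependent ℤ f) :
    -- the bound with an implied constant depending only on `n`, `r`, `f` and `d = [k : ℚ]`
    (∀ d : ℕ, ∃ C : ℝ, 0 < C ∧
      ∀ (G : Subgroup (Equiv.Perm (Fin n))), MulAction.IsPretransitive G (Fin n) →
      (∀ i, InvariantBound.IsInvariant G (f i)) →
      ∀ (k Ω : Type*) [Field k] [NumberField k] [Field Ω] [Algebra k Ω] [IsAlgClosure k Ω],
      Module.finrank ℚ k = d → ∀ X : ℝ, 1 ≤ X →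
        (InvariantBound.extensions k Ω G X).Finite ∧
        ((InvariantBound.extensions k Ω G X).ncard : ℝ) ≤
          C * X ^ ((InvariantBound.degSum f : ℝ) / n - (r : ℝ) / 2) *
            ((|NumberField.discr k| : ℤ) : ℝ) ^ (-((n : ℝ) * r / 2))) ∧
    -- the explicit bounds, the first one for the fields with `λ_max(K) ≤ l`
    (∀ (G : Subgroup (Equiv.Perm (Fin n))), MulAction.IsPretransitive G (Fin n) →
      (∀ i, InvariantBound.IsInvariant G (f i)) →
      ∀ (k Ω : Type*) [Field k] [NumberField k] [Field Ω] [Algebra k Ω] [IsAlgClosure k Ω],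
      ∀ d : ℕ, Module.finrank ℚ k = d → ∀ X : ℝ, 1 ≤ X →
        (∀ l : ℝ, 1 ≤ l →
          (InvariantBound.extensionsMinimaLE k Ω G X l).Finite ∧
          ((InvariantBound.extensionsMinimaLE k Ω G X l).ncard : ℝ) ≤
            InvariantBound.explicitConst n r d f *
              (l ^ ((d : ℝ) * (InvariantBound.degSum f : ℝ) - (d : ℝ) * n * r) *
                  X ^ ((r : ℝ) / 2) /
                ((|NumberField.discr k| : ℤ) : ℝ) ^ ((n : ℝ) * r / 2))) ∧
        (InvariantBound.extensions k Ω G X).Finite ∧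
        ((InvariantBound.extensions k Ω G X).ncard : ℝ) ≤
          InvariantBound.explicitConst n r d f *
            (X ^ ((InvariantBound.degSum f : ℝ) / n - (r : ℝ) / 2) /
              ((|NumberField.discr k| : ℤ) : ℝ) ^ ((r : ℝ) * n / 2))) := by
  constructor
  · intro d
    rcases Nat.eq_zero_or_pos d with rfl | hd
    · exact ⟨1, one_pos, fun _ _ _ _ _ _ _ _ _ _ hd => absurd hd Module.finrank_pos.ne'⟩
    refine ⟨InvariantBound.explicitConst n r d f, InvariantBound.explicitConst_pos hn hr
      (InvariantBound.totalDegree_pos_of_algebraicIndependent hf) hd, ?_⟩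
    rintro G hG hinv k Ω _ _ _ _ _ rfl X hX
    obtain ⟨hfin, hcard⟩ := InvariantBound.extensions_finite_and_ncard_le (k := k) (Ω := Ω)
      hn hr hf hG hinv hX
    refine ⟨hfin, hcard.trans_eq ?_⟩
    rw [Real.rpow_neg (by positivity), mul_comm (r : ℝ) n, mul_assoc, div_eq_mul_inv]
  · rintro G hG hinv k Ω _ _ _ _ _ _ rfl X hX
    exact ⟨fun l hl => InvariantBound.extensionsMinimaLE_finite_and_ncard_le hn hr hf hG hinv
      (zero_le_one.trans hX) hl,
      InvariantBound.extensions_finite_and_ncard_le hn hr hf hG hinv hX⟩
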